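/- Let $n\ge 2$, let $\rho>0$, and let $B=B(0,\rho)\subset\mathbb{R}^n$ be the open ball. Let $\Omega\subset\mathbb{R}^n$ be a bounded domain which contains $B$ and is star-shaped with respect to $B$ (that is, for every $z\in B$ and $x\in\Omega$ the segment from $z$ to $x$ lies in $\Omega$). Let $\varphi\in C_0^\infty(B)$ and $j\in\{1,\dots,n\}$. Let $f\in L^2(\mathbb{R}^n)$ vanish outside $\Omega$, and for $0<\varepsilon<1$ put $$T_\varepsilon f(x)=\int_\varepsilon^1\int_{\mathbb{R}^n}\frac{\partial}{\partial x_j}\left[\varphi\left(y+\frac{x-y}{t}\right)\right]f(y)\,dy\,\frac{dt}{t^n}.$$ Then, as $\varepsilon\to0^+$, $T_\varepsilon f$ converges in the space $\mathcal{S}'(\mathbb{R}^n)$ of tempered distributions to a function $Tf\in L^2(\mathbb{R}^n)$, and for every real $p$ with $1\le p<\frac{n}{n-1}$, with $p'$ given by $\frac1p+\frac1{p'}=1$ (so $n/p'=0$ if $p=1$), $$\|Tf\|_{L^2(\Omega)}\le\left(2^{\frac{n-1}{2}}C_{\varphi,\rho}+\frac{2^{\frac n2}}{(1-\frac{n}{p'})^{\frac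 p2}}\,\widetilde C_{\varphi,p}\,|\Omega|^{1-\frac p2}\right)\|f\|_{L^2(\Omega)},$$ where $|\Omega|$ is the Lebesgue measure of $\Omega$, $$C_{\varphi,\rho}=\rho^{-1}\|\varphi\|_{L^1(\mathbb{R}^n)}+\rho\left\|\frac{\partial^2\varphi}{\partial x_j^2}\right\|_{L^1(\mathbb{R}^n)} \quad\text{and}\quad \widetilde C_{\varphi,p}=\left\|\frac{\partial\varphi}{\partial x_j}\right\|_{L^1(\mathbb{R}^n)}^{\frac p2}\left\|\frac{\partial\varphi}{\partial x_j}\right\|_{L^\infty(\Omega)}^{1-\frac p2}.$$ Functions may be complex valued. -/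

import Mathlib

open MeasureTheory Filter Topology
open scoped ContDiff SchwartzMap ENNReal

noncomputable section

/-- The classical partial derivative `∂g/∂x_j` of a function `g : ℝⁿ → ℂ`. -/
def partialDeriv {n : ℕ} (j : Fin n) (g : EuclideanSpace ℝ (Fin n) → ℂ)
    (x : EuclideanSpace ℝ (Fin n)) : ℂ :=
  lineDeriv ℝ g x (EuclideanSpace.single j 1)

/-- The truncated operator
`T_ε f(x) = ∫_ε^1 ∫ ∂/∂x_j [φ (y + (x - y) / t)] f(y) dy dt / t^n`. -/
def truncatedOp {n : ℕ} (j : Fin n) (φ f : EuclideanSpace ℝ (Fin n) → ℂ) (ε : ℝ)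
    (x : EuclideanSpace ℝ (Fin n)) : ℂ :=
  ∫ t in ε..1,
    (∫ y, partialDeriv j (fun x' => φ (y + t⁻¹ • (x' - y))) x * f y) / (t : ℂ) ^ n

/-- The functions `u ε` converge to the function `v` as `ε → 0⁺` in the space `𝒮'` of tempered
distributions, a function acting on a Schwartz function by integration of the product (which is
required to be integrable). -/
def IsTemperedLimit {n : ℕ} (u : ℝ → EuclideanSpace ℝ (Fin n) → ℂ)
    (v : EuclideanSpace ℝ (Fin n) → ℂ) : Prop :=
  ∀ ψ : 𝓢(EuclideanSpace ℝ (Fin n), ℂ),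
    (∀ᶠ ε in 𝓝[>] (0 : ℝ), Integrable (fun x => u ε x * ψ x)) ∧
    Integrable (fun x => v x * ψ x) ∧
    Tendsto (fun ε => ∫ x, u ε x * ψ x) (𝓝[>] (0 : ℝ)) (𝓝 (∫ x, v x * ψ x))

/-- `C_{φ,ρ} = ρ⁻¹ ‖φ‖_{L¹} + ρ ‖∂²φ/∂x_j²‖_{L¹}`. -/
def constC {n : ℕ} (j : Fin n) (φ : EuclideanSpace ℝ (Fin n) → ℂ) (ρ : ℝ) : ℝ :=
  ρ⁻¹ * lpNorm φ 1 volume + ρ * lpNorm (partialDeriv j (partialDeriv j φ)) 1 volume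

/-- `C̃_{φ,p} = ‖∂φ/∂x_j‖_{L¹(ℝⁿ)}^{p/2} ‖∂φ/∂x_j‖_{L^∞(Ω)}^{1-p/2}`. -/
def constCtilde {n : ℕ} (j : Fin n) (φ : EuclideanSpace ℝ (Fin n) → ℂ)
    (Ω : Set (EuclideanSpace ℝ (Fin n))) (p : ℝ) : ℝ :=
  lpNorm (partialDeriv j φ) 1 volume ^ (p / 2) *
    lpNorm (partialDeriv j φ) ∞ (volume.restrict Ω) ^ (1 - p / 2)

end

open Set
open scoped FourierTransform LineDeriv

/-! Carrying out the derivative turns the integrand into `t⁻¹ ^ (n + 1) * g (y + (x - y) / t) * f y`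
with `g = ∂φ/∂x_j`. The `t`-integral is cut at `1/2`; the two pieces give the two terms of the
constant.

For `t ≤ 1/2` the kernel is too singular for absolute estimates, and cancellation is captured by the
Fourier transform. The slice at `t` has transform `2πi ξ_j φ̂(tξ) f̂((1-t)ξ)`: the derivative gains
a factor `t ξ_j`, which cancels the singular `t⁻¹` (`fourier_sliceOp`, `fourier_partialDeriv`). The
bounds `|φ̂| ≤ ‖φ‖₁` and `(2πξ_j)² |φ̂| ≤ ‖∂_j²φ‖₁` make `∫₀^∞ 2π|ξ_j| |φ̂(tξ)| dt` at most
`C_{φ,ρ}`, uniformly in `ξ`. A Schur argument (`lintegral_frequency_sq_le`) and Plancherel then give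
the `L²` bound. The limit `ε → 0` is taken by dominated convergence on the Fourier side, against
Schwartz functions.

For `t > 1/2` absolute values suffice. The map `y ↦ y + (x - y) / t` degenerates at `t = 1`, where
its Jacobian costs `(1 - t)^{-n}`; Hölder's inequality keeps only the power `n/p'` of this loss,
integrable exactly when `p < n/(n-1)`. This bounds the positive operator on `L^p`
(`lintegral_positiveOp_rpow_le`). The trivial `L¹ → L^∞` bound and `S² = S^p S^{2-p}` upgrade it to
`L²`, and Hölder on `Ω` converts norms of `f` into its `L²` norm at the price of powers of `|Ω|`. -/

/-! ### Affine changes of variables -/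

theorem lintegral_comp_smul_add {n : ℕ} (F : EuclideanSpace ℝ (Fin n) → ℝ≥0∞)
    (hF : Measurable F) {a : ℝ} (ha : a ≠ 0) (b : EuclideanSpace ℝ (Fin n)) :
    ∫⁻ y, F (a • y + b) = ENNReal.ofReal ((|a| ^ n)⁻¹) * ∫⁻ y, F y := by
  have h1 : ∫⁻ y, F (a • y + b) = ∫⁻ z, F (z + b) ∂(Measure.map (a • ·) volume) := by
    rw [lintegral_map (by fun_prop) (by fun_prop)]
  rw [h1, Measure.map_addHaar_smul _ ha, lintegral_smul_measure, lintegral_add_right_eq_self]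
  simp [abs_inv, abs_pow]

/-- Scaling of the map `y ↦ y + (x - y) / t`. -/
theorem lintegral_kernel_right {n : ℕ} (G : EuclideanSpace ℝ (Fin n) → ℝ≥0∞)
    (hG : Measurable G) {t : ℝ} (ht : t ∈ Ioo (0 : ℝ) 1) (x : EuclideanSpace ℝ (Fin n)) :
    ∫⁻ y, G (y + t⁻¹ • (x - y)) = ENNReal.ofReal (t ^ n * ((1 - t) ^ n)⁻¹) * ∫⁻ y, G y := by
  have h0 := ht.1
  have h1 : 0 < 1 - t := sub_pos.2 ht.2
  have ha : 1 - t⁻¹ ≠ 0 := by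
    have : 1 < t⁻¹ := (one_lt_inv₀ ht.1).2 ht.2
    linarith
  have h : ∀ y, y + t⁻¹ • (x - y) = (1 - t⁻¹) • y + t⁻¹ • x := fun y => by module
  simp_rw [h]
  rw [lintegral_comp_smul_add G hG ha]
  have : |1 - t⁻¹| = (1 - t) / t := by
    have : 1 - t⁻¹ = -((1 - t) / t) := by field_simp; ring
    rw [this, abs_neg, abs_of_pos (by positivity)]
  rw [this, div_pow, inv_div, div_eq_mul_inv]

/-- Scaling of the map `x ↦ y + (x - y) / t`. -/
theorem lintegral_kernel_left {n : ℕ} (G : EuclideanSpace ℝ (Fin n) → ℝ≥0∞)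
    (hG : Measurable G) {t : ℝ} (ht : 0 < t) (y : EuclideanSpace ℝ (Fin n)) :
    ∫⁻ x, G (y + t⁻¹ • (x - y)) = ENNReal.ofReal (t ^ n) * ∫⁻ y, G y := by
  have h : ∀ x, y + t⁻¹ • (x - y) = t⁻¹ • x + (1 - t⁻¹) • y := fun x => by module
  simp_rw [h]
  rw [lintegral_comp_smul_add G hG (by positivity), abs_of_pos (by positivity), inv_pow, inv_inv]

/-! ### The range `1/2 < t < 1`: a positive kernel on `L^p` and `L²` -/

/-- Bounding `t⁻¹` by `2` leaves `2 (1/2)^{1-a} / (1-a)`. Applied with `a = n/p'`, so `a < 1` is the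
restriction on `p`. -/
theorem lintegral_weight_le {a : ℝ} (ha : a < 1) :
    ∫⁻ t in Ioo (1 / 2 : ℝ) 1, ENNReal.ofReal (t⁻¹ * (1 - t) ^ (-a)) ≤
      ENNReal.ofReal (2 ^ a / (1 - a)) := by
  have hint : IntervalIntegrable (fun t : ℝ => 2 * (1 - t) ^ (-a)) volume (1 / 2) 1 := by
    have := (intervalIntegral.intervalIntegrable_rpow' (a := 1 / 2) (b := 0) (r := -a)
      (by linarith)).comp_sub_left 1
    norm_num at this
    exact this.const_mul 2
  have hval : ∫ t in (1 / 2 : ℝ)..1, 2 * (1 - t) ^ (-a) = 2 ^ a / (1 - a) := by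
    rw [intervalIntegral.integral_const_mul,
      intervalIntegral.integral_comp_sub_left (fun t : ℝ => t ^ (-a)) 1,
      integral_rpow (Or.inl (by linarith))]
    norm_num
    rw [Real.zero_rpow (by linarith), Real.rpow_add (by norm_num), Real.rpow_one,
      Real.div_rpow (by norm_num) (by norm_num), Real.one_rpow, Real.rpow_neg (by norm_num)]
    have : -a + 1 = 1 - a := by ring
    rw [this]
    field_simp
    norm_num
  calc _ ≤ ∫⁻ t in Ioo (1 / 2 : ℝ) 1, ENNReal.ofReal (2 * (1 - t) ^ (-a)) := by
        refine setLIntegral_mono' measurableSet_Ioo fun t ht => ENNReal.ofReal_le_ofReal ?_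
        have h1 : 0 < 1 - t := sub_pos.2 ht.2
        have : t⁻¹ ≤ 2 := by
          rw [inv_le_comm₀ (by linarith [ht.1]) two_pos]; linarith [ht.1]
        gcongr
    _ ≤ ∫⁻ t in Ioc (1 / 2 : ℝ) 1, ENNReal.ofReal (2 * (1 - t) ^ (-a)) :=
        lintegral_mono_set Ioo_subset_Ioc_self
    _ = ENNReal.ofReal (∫ t in Ioc (1 / 2 : ℝ) 1, 2 * (1 - t) ^ (-a)) := by
        refine (ofReal_integral_eq_lintegral_ofReal hint.1 ?_).symm
        filter_upwards [ae_restrict_mem measurableSet_Ioc] with t ht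
        have : 0 ≤ 1 - t := sub_nonneg.2 ht.2
        positivity
    _ = _ := by
        rw [← intervalIntegral.integral_of_le (by norm_num), hval]

/-- The operator with positive kernel `∫_{1/2}^1 G (y + (x - y) / t) dt / t ^ (n + 1)`. -/
noncomputable def positiveOp {n : ℕ} (G F : EuclideanSpace ℝ (Fin n) → ℝ≥0∞)
    (x : EuclideanSpace ℝ (Fin n)) : ℝ≥0∞ :=
  ∫⁻ t in Ioo (1 / 2 : ℝ) 1, ∫⁻ y, ENNReal.ofReal (t⁻¹ ^ (n + 1)) * G (y + t⁻¹ • (x - y)) * F y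

/-- Here `t⁻¹ ≤ 2` gives `2 ^ (n + 1)`, and the length `1/2` of the interval removes one factor. -/
theorem positiveOp_le {n : ℕ} {G F : EuclideanSpace ℝ (Fin n) → ℝ≥0∞}
    (hF : Measurable F) {M : ℝ≥0∞} (hM : ∀ x, G x ≤ M) (x : EuclideanSpace ℝ (Fin n)) :
    positiveOp G F x ≤ 2 ^ n * M * ∫⁻ y, F y := by
  calc positiveOp G F x
      ≤ ∫⁻ t in Ioo (1 / 2 : ℝ) 1, ENNReal.ofReal (2 ^ (n + 1)) * M * ∫⁻ y, F y := by
        refine setLIntegral_mono' measurableSet_Ioo fun t ht => ?_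
        rw [← lintegral_const_mul _ hF]
        refine lintegral_mono fun y => ?_
        have : t⁻¹ ≤ 2 := by
          rw [inv_le_comm₀ (by linarith [ht.1]) two_pos]; linarith [ht.1]
        have h0 : 0 ≤ t⁻¹ := inv_nonneg.2 (by linarith [ht.1])
        gcongr
        exact hM _
    _ = _ := by
        rw [setLIntegral_const, Real.volume_Ioo, ENNReal.ofReal_pow zero_le_two, pow_succ,
          mul_comm _ (ENNReal.ofReal _)]
        norm_num
        rw [← mul_assoc, ← mul_assoc, ← mul_assoc, mul_right_comm _ _ (2 : ℝ≥0∞),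
          show (1 / 2 : ℝ) = 2⁻¹ by norm_num, ENNReal.ofReal_inv_of_pos two_pos,
          ENNReal.ofReal_ofNat, ENNReal.inv_mul_cancel two_ne_zero ENNReal.ofNat_ne_top, one_mul]

/-- Hölder in `(t, y)` jointly, with the kernel shared between a factor integrated in `y` for fixed
`x` and one integrated in `x` for fixed `y`. The weight `w` is chosen so that both integrals reduce
to `∫ w`. -/
theorem lintegral_positiveOp_rpow_le {n : ℕ} {G F : EuclideanSpace ℝ (Fin n) → ℝ≥0∞}
    (hG : Measurable G) (hF : Measurable F) {p : ℝ} (hp : 1 ≤ p)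
    (ha : (n : ℝ) * (1 - 1 / p) < 1) :
    ∫⁻ x, positiveOp G F x ^ p ≤
      (ENNReal.ofReal (2 ^ ((n : ℝ) * (1 - 1 / p)) / (1 - (n : ℝ) * (1 - 1 / p))) *
        ∫⁻ x, G x) ^ p * ∫⁻ x, F x ^ p := by
  have hp0 : 0 < p := by linarith
  have hq0 : 0 ≤ 1 - 1 / p := by
    rw [sub_nonneg, div_le_one hp0]; exact hp
  set a := (n : ℝ) * (1 - 1 / p) with ha_def
  have ha0 : 0 ≤ a := by positivity
  set W := ENNReal.ofReal (2 ^ a / (1 - a))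
  set I := Ioo (1 / 2 : ℝ) 1
  set w : ℝ → ℝ := fun t => t⁻¹ * (1 - t) ^ (-a)
  have hwm : Measurable w := by fun_prop
  -- The factor `(1 - t) ^ n` in `A` cancels the Jacobian of `y ↦ y + (x - y) / t`. `B` needs none,
  -- since integration in `x` only costs `t ^ n`. The power `(1 - t) ^ (-a)` in `w` makes `A ^ (1 -
  -- 1/p) * B ^ (1/p)` the original integrand.
  set A : EuclideanSpace ℝ (Fin n) → ℝ × EuclideanSpace ℝ (Fin n) → ℝ≥0∞ := fun x z =>
    ENNReal.ofReal (w z.1 * (1 - z.1) ^ n * z.1⁻¹ ^ n) * G (z.2 + z.1⁻¹ • (x - z.2)) with hA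
  set B : EuclideanSpace ℝ (Fin n) → ℝ × EuclideanSpace ℝ (Fin n) → ℝ≥0∞ := fun x z =>
    ENNReal.ofReal (w z.1 * z.1⁻¹ ^ n) * G (z.2 + z.1⁻¹ • (x - z.2)) * F z.2 ^ p with hB
  have hAm : ∀ x, Measurable (A x) := fun x => by fun_prop
  have hBm2 : Measurable (Function.uncurry B) := by
    simp only [hB, Function.uncurry_def]; fun_prop
  have hBm : ∀ x, Measurable (B x) := fun x => by fun_prop
  set ν : Measure (ℝ × EuclideanSpace ℝ (Fin n)) := (volume.restrict I).prod volume
  have hIA : ∀ x, ∫⁻ z, A x z ∂ν ≤ W * ∫⁻ y, G y := by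
    intro x
    rw [lintegral_prod _ (hAm x).aemeasurable]
    calc _ = ∫⁻ t in I, ENNReal.ofReal (w t) * ∫⁻ y, G y := by
          refine setLIntegral_congr_fun measurableSet_Ioo fun t ht => ?_
          have h0 : 0 < t := by linarith [ht.1]
          have h1 : 0 < 1 - t := sub_pos.2 ht.2
          simp only [hA]
          rw [lintegral_const_mul _ (by fun_prop), lintegral_kernel_right G hG ⟨h0, ht.2⟩,
            ← mul_assoc, ← ENNReal.ofReal_mul (by positivity)]
          congr 2
          rw [inv_pow]
          field_simp
      _ = (∫⁻ t in I, ENNReal.ofReal (w t)) * ∫⁻ y, G y :=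
          lintegral_mul_const _ (by fun_prop)
      _ ≤ _ := by gcongr; exact lintegral_weight_le ha
  have hSx : ∀ x, positiveOp G F x ^ p ≤ (W * ∫⁻ y, G y) ^ (p - 1) * ∫⁻ z, B x z ∂ν := by
    intro x
    have h1 : positiveOp G F x = ∫⁻ z, A x z ^ (1 - 1 / p) * B x z ^ (1 / p) ∂ν := by
      rw [lintegral_prod _ (by fun_prop), positiveOp]
      refine setLIntegral_congr_fun measurableSet_Ioo fun t ht => ?_
      refine lintegral_congr fun y => ?_
      have h0 : 0 < t := by linarith [ht.1]
      have h1 : 0 < 1 - t := sub_pos.2 ht.2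
      have hw : 0 < w t := by simp only [w]; positivity
      simp only [hA, hB]
      rw [ENNReal.mul_rpow_of_nonneg _ _ hq0, ENNReal.mul_rpow_of_nonneg _ _ (by positivity),
        ENNReal.mul_rpow_of_nonneg _ _ (by positivity), ← ENNReal.rpow_mul,
        mul_one_div_cancel hp0.ne', ENNReal.rpow_one,
        ENNReal.ofReal_rpow_of_nonneg (by positivity) hq0,
        ENNReal.ofReal_rpow_of_nonneg (by positivity) (by positivity)]
      have hG' : ∀ c : ℝ≥0∞, c = c ^ (1 - 1 / p) * c ^ (1 / p) := fun c => by
        rw [← ENNReal.rpow_add_of_nonneg _ _ hq0 (by positivity), sub_add_cancel,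
          ENNReal.rpow_one]
      have hr : t⁻¹ ^ (n + 1) = (w t * (1 - t) ^ n * t⁻¹ ^ n) ^ (1 - 1 / p) *
          (w t * t⁻¹ ^ n) ^ (1 / p) := by
        have e : w t * (1 - t) ^ n * t⁻¹ ^ n = (1 - t) ^ n * (w t * t⁻¹ ^ n) := by ring
        rw [e, Real.mul_rpow (by positivity) (by positivity), mul_assoc,
          ← Real.rpow_add (by positivity), sub_add_cancel, Real.rpow_one, ← Real.rpow_natCast (1 - t) n,
          ← Real.rpow_mul h1.le, ← ha_def]
        simp only [w]
        rw [show (1 - t) ^ a * (t⁻¹ * (1 - t) ^ (-a) * t⁻¹ ^ n)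
          = ((1 - t) ^ a * (1 - t) ^ (-a)) * (t⁻¹ * t⁻¹ ^ n) by ring, ← Real.rpow_add h1]
        rw [add_neg_cancel, Real.rpow_zero]; ring
      rw [hr, ENNReal.ofReal_mul (by positivity)]
      nth_rw 1 [hG' (G (y + t⁻¹ • (x - y)))]
      ring
    calc positiveOp G F x ^ p
        ≤ ((∫⁻ z, A x z ∂ν) ^ (1 - 1 / p) * (∫⁻ z, B x z ∂ν) ^ (1 / p)) ^ p := by
          rw [h1]
          gcongr
          exact ENNReal.lintegral_mul_norm_pow_le (hAm x).aemeasurable (hBm x).aemeasurable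
            hq0 (by positivity) (by ring)
      _ = (∫⁻ z, A x z ∂ν) ^ (p - 1) * ∫⁻ z, B x z ∂ν := by
          rw [ENNReal.mul_rpow_of_nonneg _ _ hp0.le, ← ENNReal.rpow_mul, ← ENNReal.rpow_mul,
            one_div_mul_cancel hp0.ne', ENNReal.rpow_one, sub_mul, one_div_mul_cancel hp0.ne',
            one_mul]
      _ ≤ _ := by
          gcongr
          exact hIA x
  have hIB : ∫⁻ x, ∫⁻ z, B x z ∂ν ≤ W * (∫⁻ y, G y) * ∫⁻ y, F y ^ p := by
    rw [lintegral_lintegral_swap hBm2.aemeasurable, lintegral_prod]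
    swap
    · exact (hBm2.lintegral_prod_left' ).aemeasurable
    calc _ = ∫⁻ t in I, ENNReal.ofReal (w t) * ((∫⁻ y, G y) * ∫⁻ y, F y ^ p) := by
          refine setLIntegral_congr_fun measurableSet_Ioo fun t ht => ?_
          have h0 : 0 < t := by linarith [ht.1]
          have h1 : 0 < 1 - t := sub_pos.2 ht.2
          have hw : 0 < w t := by simp only [w]; positivity
          calc _ = ∫⁻ y, ENNReal.ofReal (w t) * (∫⁻ y, G y) * F y ^ p := by
                refine lintegral_congr fun y => ?_
                simp only [hB]
                rw [lintegral_mul_const _ (by fun_prop), lintegral_const_mul _ (by fun_prop),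
                  lintegral_kernel_left G hG h0, ← mul_assoc, ← ENNReal.ofReal_mul (by positivity)]
                congr 3
                rw [inv_pow]
                field_simp
            _ = _ := by rw [lintegral_const_mul _ (by fun_prop), mul_assoc]
      _ = (∫⁻ t in I, ENNReal.ofReal (w t)) * ((∫⁻ y, G y) * ∫⁻ y, F y ^ p) :=
          lintegral_mul_const _ (by fun_prop)
      _ ≤ _ := by rw [mul_assoc]; gcongr; exact lintegral_weight_le ha
  calc ∫⁻ x, positiveOp G F x ^ p
      ≤ ∫⁻ x, (W * ∫⁻ y, G y) ^ (p - 1) * ∫⁻ z, B x z ∂ν := lintegral_mono hSx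
    _ = (W * ∫⁻ y, G y) ^ (p - 1) * ∫⁻ x, ∫⁻ z, B x z ∂ν :=
        lintegral_const_mul _ (hBm2.lintegral_prod_right')
    _ ≤ (W * ∫⁻ y, G y) ^ (p - 1) * (W * (∫⁻ y, G y) * ∫⁻ y, F y ^ p) := by gcongr
    _ = _ := by
        rw [← mul_assoc]
        congr 1
        nth_rw 2 [← ENNReal.rpow_one (W * ∫⁻ y, G y)]
        rw [← ENNReal.rpow_add_of_nonneg _ _ (by linarith) zero_le_one, sub_add_cancel]

theorem lintegral_positiveOp_sq_le {n : ℕ} {G F : EuclideanSpace ℝ (Fin n) → ℝ≥0∞}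
    (hG : Measurable G) (hF : Measurable F) {p : ℝ} (hp : 1 ≤ p) (hp2 : p ≤ 2)
    (ha : (n : ℝ) * (1 - 1 / p) < 1) {M : ℝ≥0∞} (hM : ∀ x, G x ≤ M) :
    ∫⁻ x, positiveOp G F x ^ (2 : ℝ) ≤
      (ENNReal.ofReal (2 ^ ((n : ℝ) * (1 - 1 / p)) / (1 - (n : ℝ) * (1 - 1 / p))) *
        ∫⁻ x, G x) ^ p * (∫⁻ x, F x ^ p) * (2 ^ n * M * ∫⁻ y, F y) ^ (2 - p) := by
  have hm : Measurable (positiveOp G F) := by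
    unfold positiveOp
    refine Measurable.lintegral_prod_right' (f := fun z : EuclideanSpace ℝ (Fin n) × ℝ =>
      ∫⁻ y, ENNReal.ofReal (z.2⁻¹ ^ (n + 1)) * G (y + z.2⁻¹ • (z.1 - y)) * F y) ?_
    refine Measurable.lintegral_prod_right'
      (f := fun z : (EuclideanSpace ℝ (Fin n) × ℝ) × EuclideanSpace ℝ (Fin n) =>
      ENNReal.ofReal (z.1.2⁻¹ ^ (n + 1)) * G (z.2 + z.1.2⁻¹ • (z.1.1 - z.2)) * F z.2) ?_
    fun_prop
  calc ∫⁻ x, positiveOp G F x ^ (2 : ℝ)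
      ≤ ∫⁻ x, positiveOp G F x ^ p * (2 ^ n * M * ∫⁻ y, F y) ^ (2 - p) := by
        refine lintegral_mono fun x => ?_
        have : (2 : ℝ) = p + (2 - p) := by ring
        nth_rw 1 [this]
        rw [ENNReal.rpow_add_of_nonneg _ _ (by linarith) (by linarith)]
        have h2 : 0 ≤ 2 - p := by linarith
        gcongr
        exact positiveOp_le hF hM x
    _ = (∫⁻ x, positiveOp G F x ^ p) * (2 ^ n * M * ∫⁻ y, F y) ^ (2 - p) :=
        lintegral_mul_const _ (hm.pow_const p)
    _ ≤ _ := by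
        gcongr
        exact lintegral_positiveOp_rpow_le hG hF hp ha

/-! ### The range `0 < t ≤ 1/2`: a Schur estimate in frequency -/

theorem lintegral_Ioi_le_of_bounds {κ : ℝ → ℝ} {r A B ρ : ℝ} (hρ : 0 < ρ)
    (hr : 0 ≤ r) (hA0 : 0 ≤ A) (hB0 : 0 ≤ B) (hA : ∀ t, κ t ≤ A)
    (hB : ∀ t, (t * r) ^ 2 * κ t ≤ B) :
    ∫⁻ t in Ioi (0 : ℝ), ENNReal.ofReal (r * κ t) ≤ ENNReal.ofReal (ρ⁻¹ * A + ρ * B) := by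
  rcases hr.eq_or_lt with rfl | hr
  · simp
  -- At this cut the constant bound contributes `r * A * s = ρ⁻¹ * A`, and the decay bound
  -- contributes `B / (r * s) = ρ * B`.
  set s := (ρ * r)⁻¹ with hs
  have hs0 : 0 < s := by positivity
  have hint := integrableOn_Ioi_rpow_of_lt (a := (-2 : ℝ)) (by norm_num) hs0
  have hval := integral_Ioi_rpow_of_lt (a := (-2 : ℝ)) (by norm_num) hs0
  rw [← Ioc_union_Ioi_eq_Ioi hs0.le,
    lintegral_union measurableSet_Ioi (Ioc_disjoint_Ioi le_rfl),
    ENNReal.ofReal_add (by positivity) (by positivity)]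
  refine add_le_add ?_ ?_
  · calc _ ≤ ∫⁻ t in Ioc (0 : ℝ) s, ENNReal.ofReal (r * A) :=
          lintegral_mono fun t => ENNReal.ofReal_le_ofReal (by gcongr; exact hA t)
      _ = _ := by
          rw [setLIntegral_const, Real.volume_Ioc, ← ENNReal.ofReal_mul (by positivity)]
          congr 1
          rw [hs]; field_simp; ring
  · calc _ ≤ ∫⁻ t in Ioi s, ENNReal.ofReal (B / r * t ^ (-2 : ℝ)) := by
          refine setLIntegral_mono' measurableSet_Ioi fun t ht => ENNReal.ofReal_le_ofReal ?_
          have ht0 : 0 < t := hs0.trans ht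
          have := hB t
          rw [Real.rpow_neg ht0.le, Real.rpow_two, ← div_eq_mul_inv, div_div, le_div_iff₀ (by positivity)]
          linarith [show r * κ t * (r * t ^ 2) = (t * r) ^ 2 * κ t by ring]
      _ = ENNReal.ofReal (∫ t in Ioi s, B / r * t ^ (-2 : ℝ)) := by
          refine (ofReal_integral_eq_lintegral_ofReal (hint.const_mul _) ?_).symm
          filter_upwards [ae_restrict_mem measurableSet_Ioi] with t ht
          have ht0 : 0 < t := hs0.trans ht
          positivity
      _ ≤ _ := by
          refine ENNReal.ofReal_le_ofReal (le_of_eq ?_)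
          rw [integral_const_mul, hval]
          norm_num
          rw [Real.rpow_neg_one, hs]
          field_simp

/-- Substitute `s = t / (1 - t)`, with `ds = dt / (1 - t)²`. The remaining `(1 - t)^{-(n-1)}` is at
most `2 ^ (n - 1)` because `1 - t ≥ 1/2`. -/
theorem lintegral_weighted_comp_div_le (n : ℕ) (hn : 1 ≤ n) (K : ℝ → ℝ≥0∞) :
    ∫⁻ t in Ioc (0 : ℝ) (1 / 2), ENNReal.ofReal (((1 - t) ^ (n + 1))⁻¹) * K (t / (1 - t)) ≤
      2 ^ (n - 1) * ∫⁻ s in Ioi (0 : ℝ), K s := by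
  have hinj : InjOn (fun t : ℝ => t / (1 - t)) (Ioc (0 : ℝ) (1 / 2)) := by
    intro a ha b hb hab
    have h1 : 1 - a ≠ 0 := by linarith [ha.2]
    have h2 : 1 - b ≠ 0 := by linarith [hb.2]
    rw [div_eq_div_iff h1 h2] at hab
    linarith
  have hder : ∀ t ∈ Ioc (0 : ℝ) (1 / 2),
      HasDerivWithinAt (fun t : ℝ => t / (1 - t)) (((1 - t) ^ 2)⁻¹) (Ioc (0 : ℝ) (1 / 2)) t := by
    intro t ht
    have h1 : 1 - t ≠ 0 := by linarith [ht.2]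
    have h : HasDerivAt (fun t : ℝ => t / (1 - t)) ((1 * (1 - t) - t * -1) / (1 - t) ^ 2) t :=
      (hasDerivAt_id t).div ((hasDerivAt_id t).const_sub 1) h1
    have e : (1 * (1 - t) - t * -1) / (1 - t) ^ 2 = ((1 - t) ^ 2)⁻¹ := by
      field_simp
      ring
    exact (e ▸ h).hasDerivWithinAt
  calc _ ≤ ∫⁻ t in Ioc (0 : ℝ) (1 / 2), 2 ^ (n - 1) *
        (ENNReal.ofReal |((1 - t) ^ 2)⁻¹| * K (t / (1 - t))) := by
        refine setLIntegral_mono' measurableSet_Ioc fun t ht => ?_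
        have h1 : 1 / 2 ≤ 1 - t := by linarith [ht.2]
        have h0 : 0 < 1 - t := by linarith
        rw [← mul_assoc]
        gcongr
        rw [abs_of_pos (by positivity), ← ENNReal.ofReal_ofNat 2, ← ENNReal.ofReal_pow zero_le_two,
          ← ENNReal.ofReal_mul (by positivity)]
        refine ENNReal.ofReal_le_ofReal ?_
        have : n + 1 = (n - 1) + 2 := by omega
        rw [this, pow_add, mul_inv, ← inv_pow]
        gcongr
        rw [inv_le_comm₀ h0 two_pos]; linarith
    _ = 2 ^ (n - 1) * ∫⁻ t in Ioc (0 : ℝ) (1 / 2),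
        (ENNReal.ofReal |((1 - t) ^ 2)⁻¹| * K (t / (1 - t))) :=
        lintegral_const_mul' _ _ (by finiteness)
    _ = 2 ^ (n - 1) * ∫⁻ s in (fun t : ℝ => t / (1 - t)) '' Ioc (0 : ℝ) (1 / 2), K s := by
        rw [lintegral_image_eq_lintegral_abs_deriv_mul measurableSet_Ioc hder hinj]
    _ ≤ _ := by
        gcongr
        rintro _ ⟨t, ht, rfl⟩
        exact div_pos ht.1 (by linarith [ht.2])

/-- Schur's test: Cauchy–Schwarz against the weight `k ξ t` yields one factor `C`. After Fubini and
`η = (1 - t) ξ`, integrating the kernel for fixed `η` yields the second, together with `2 ^ (n -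
1)`. -/
theorem lintegral_frequency_sq_le {n : ℕ} (j : Fin n)
    {κ F : EuclideanSpace ℝ (Fin n) → ℝ≥0∞} (hκ : Measurable κ) (hF : Measurable F) {C : ℝ≥0∞}
    (hC : ∀ ξ, ∫⁻ t in Ioi (0 : ℝ), ENNReal.ofReal (2 * Real.pi * |ξ j|) * κ (t • ξ) ≤ C) :
    ∫⁻ ξ, (∫⁻ t in Ioc (0 : ℝ) (1 / 2),
      ENNReal.ofReal (2 * Real.pi * |ξ j|) * κ (t • ξ) * F ((1 - t) • ξ)) ^ (2 : ℝ) ≤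
      2 ^ (n - 1) * C ^ (2 : ℝ) * ∫⁻ ξ, F ξ ^ (2 : ℝ) := by
  have hn : 1 ≤ n := j.pos
  set I := Ioc (0 : ℝ) (1 / 2)
  set k : EuclideanSpace ℝ (Fin n) → ℝ → ℝ≥0∞ := fun ξ t =>
    ENNReal.ofReal (2 * Real.pi * |ξ j|) * κ (t • ξ) with hk
  have hkC : ∀ ξ, ∫⁻ t in I, k ξ t ≤ C := fun ξ =>
    (lintegral_mono_set fun t ht => ht.1).trans (hC ξ)
  have hschur : ∀ ξ, (∫⁻ t in I, k ξ t * F ((1 - t) • ξ)) ^ (2 : ℝ) ≤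
      C * ∫⁻ t in I, k ξ t * F ((1 - t) • ξ) ^ (2 : ℝ) := by
    intro ξ
    have h1 : ∫⁻ t in I, k ξ t * F ((1 - t) • ξ) =
        ∫⁻ t in I, k ξ t ^ (1 / 2 : ℝ) * (k ξ t * F ((1 - t) • ξ) ^ (2 : ℝ)) ^ (1 / 2 : ℝ) := by
      refine lintegral_congr fun t => ?_
      generalize k ξ t = c
      rw [ENNReal.mul_rpow_of_nonneg _ _ (by norm_num), ← mul_assoc,
        ← ENNReal.rpow_add_of_nonneg _ _ (by norm_num) (by norm_num), ← ENNReal.rpow_mul]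
      norm_num
    calc _ ≤ ((∫⁻ t in I, k ξ t) ^ (1 / 2 : ℝ) *
          (∫⁻ t in I, k ξ t * F ((1 - t) • ξ) ^ (2 : ℝ)) ^ (1 / 2 : ℝ)) ^ (2 : ℝ) := by
          rw [h1]
          gcongr
          refine ENNReal.lintegral_mul_norm_pow_le ?_ ?_ (by norm_num) (by norm_num) (by norm_num)
          · simp only [hk]; fun_prop
          · simp only [hk]; fun_prop
      _ = (∫⁻ t in I, k ξ t) * ∫⁻ t in I, k ξ t * F ((1 - t) • ξ) ^ (2 : ℝ) := by
          rw [ENNReal.mul_rpow_of_nonneg _ _ (by norm_num), ← ENNReal.rpow_mul, ← ENNReal.rpow_mul]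
          norm_num
      _ ≤ _ := by gcongr; exact hkC ξ
  have hm : Measurable (Function.uncurry fun (ξ : EuclideanSpace ℝ (Fin n)) (t : ℝ) =>
      k ξ t * F ((1 - t) • ξ) ^ (2 : ℝ)) := by
    simp only [hk, Function.uncurry_def]; fun_prop
  have hm' : Measurable (Function.uncurry fun (t : ℝ) (η : EuclideanSpace ℝ (Fin n)) =>
      F η ^ (2 : ℝ) * (ENNReal.ofReal (((1 - t) ^ (n + 1))⁻¹) * k η (t / (1 - t)))) := by
    simp only [hk, Function.uncurry_def]; fun_prop
  calc _ ≤ ∫⁻ ξ, C * ∫⁻ t in I, k ξ t * F ((1 - t) • ξ) ^ (2 : ℝ) := lintegral_mono hschur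
    _ = C * ∫⁻ ξ, ∫⁻ t in I, k ξ t * F ((1 - t) • ξ) ^ (2 : ℝ) :=
        lintegral_const_mul _ hm.lintegral_prod_right'
    _ = C * ∫⁻ t in I, ∫⁻ ξ, k ξ t * F ((1 - t) • ξ) ^ (2 : ℝ) := by
        rw [lintegral_lintegral_swap hm.aemeasurable]
    _ = C * ∫⁻ t in I, ∫⁻ η, F η ^ (2 : ℝ) *
          (ENNReal.ofReal (((1 - t) ^ (n + 1))⁻¹) * k η (t / (1 - t))) := by
        congr 1
        refine setLIntegral_congr_fun measurableSet_Ioc fun t ht => ?_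
        have h0 : 0 < 1 - t := by linarith [ht.2]
        have hΦ : Measurable fun η : EuclideanSpace ℝ (Fin n) =>
            k ((1 - t)⁻¹ • η) t * F η ^ (2 : ℝ) := by
          simp only [hk]; fun_prop
        have := lintegral_comp_smul_add _ hΦ h0.ne' 0
        simp only [add_zero, smul_smul, inv_mul_cancel₀ h0.ne', one_smul] at this
        rw [this, ← lintegral_const_mul _ hΦ]
        refine lintegral_congr fun η => ?_
        -- The Jacobian gives `(1 - t)^{-n}`; the linear factor `|ξ j| = |η j| / (1 - t)` gives one
        -- more power, and `κ` is evaluated at `(t / (1 - t)) • η`.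
        simp only [hk, smul_smul, PiLp.smul_apply, smul_eq_mul, abs_mul, abs_of_pos h0,
          abs_of_pos (inv_pos.2 h0)]
        rw [← div_eq_mul_inv t, mul_comm (F η ^ (2 : ℝ)), ← mul_assoc, ← mul_assoc, ← mul_assoc,
          ← mul_assoc, ← ENNReal.ofReal_mul (by positivity), ← ENNReal.ofReal_mul (by positivity)]
        congr 3
        field_simp
        ring
    _ = C * ∫⁻ η, ∫⁻ t in I, F η ^ (2 : ℝ) *
          (ENNReal.ofReal (((1 - t) ^ (n + 1))⁻¹) * k η (t / (1 - t))) := by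
        rw [lintegral_lintegral_swap hm'.aemeasurable]
    _ ≤ C * ∫⁻ η, F η ^ (2 : ℝ) * (2 ^ (n - 1) * C) := by
        gcongr with η
        rw [lintegral_const_mul _ (by simp only [hk]; fun_prop)]
        gcongr
        refine (lintegral_weighted_comp_div_le n hn (k η)).trans ?_
        gcongr
        exact hC η
    _ = _ := by
        rw [lintegral_mul_const _ (by fun_prop), ENNReal.rpow_two]
        ring

/-! ### Slices at fixed `t`: integrability and Fourier transform -/

/-- The integrand of the truncated operator, after the differentiation has been carried out. -/
noncomputable def scaledKernel {n : ℕ} (g f : EuclideanSpace ℝ (Fin n) → ℂ) (t : ℝ)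
    (x y : EuclideanSpace ℝ (Fin n)) : ℂ :=
  ((t⁻¹ ^ (n + 1) : ℝ) : ℂ) * g (y + t⁻¹ • (x - y)) * f y

/-- The integral of the kernel over the `y` variable. -/
noncomputable def sliceOp {n : ℕ} (g f : EuclideanSpace ℝ (Fin n) → ℂ) (t : ℝ)
    (x : EuclideanSpace ℝ (Fin n)) : ℂ :=
  ∫ y, scaledKernel g f t x y

theorem partialDeriv_comp_affine {n : ℕ} (j : Fin n) (φ : EuclideanSpace ℝ (Fin n) → ℂ) (t : ℝ)
    (x y : EuclideanSpace ℝ (Fin n)) :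
    partialDeriv j (fun x' => φ (y + t⁻¹ • (x' - y))) x =
      (t⁻¹ : ℝ) * partialDeriv j φ (y + t⁻¹ • (x - y)) := by
  unfold partialDeriv lineDeriv
  have h : ∀ s : ℝ, y + t⁻¹ • (x + s • EuclideanSpace.single j (1 : ℝ) - y) =
      (y + t⁻¹ • (x - y)) + (t⁻¹ * s) • EuclideanSpace.single j (1 : ℝ) := fun s => by module
  simp_rw [h]
  rw [deriv_comp_mul_left t⁻¹ (fun s : ℝ =>
    φ ((y + t⁻¹ • (x - y)) + s • EuclideanSpace.single j (1 : ℝ)))]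
  simp

theorem truncatedOp_eq {n : ℕ} (j : Fin n) (φ f : EuclideanSpace ℝ (Fin n) → ℂ) (ε : ℝ)
    (x : EuclideanSpace ℝ (Fin n)) :
    truncatedOp j φ f ε x = ∫ t in ε..1, sliceOp (partialDeriv j φ) f t x := by
  unfold truncatedOp sliceOp
  congr 1
  ext t
  rw [← integral_div]
  congr 1
  ext y
  rw [partialDeriv_comp_affine, scaledKernel]
  push_cast
  rw [pow_succ, inv_pow, div_eq_mul_inv]
  ring

theorem enorm_scaledKernel {n : ℕ} (g f : EuclideanSpace ℝ (Fin n) → ℂ) {t : ℝ} (ht : 0 < t)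
    (x y : EuclideanSpace ℝ (Fin n)) :
    ‖scaledKernel g f t x y‖ₑ =
      ENNReal.ofReal (t⁻¹ ^ (n + 1)) * ‖g (y + t⁻¹ • (x - y))‖ₑ * ‖f y‖ₑ := by
  rw [scaledKernel, enorm_mul, enorm_mul]
  congr 2
  rw [← ofReal_norm, Complex.norm_real, Real.norm_of_nonneg (by positivity)]

theorem measurable_scaledKernel {n : ℕ} {g f : EuclideanSpace ℝ (Fin n) → ℂ}
    (hg : Measurable g) (hf : Measurable f) :
    Measurable fun z : (ℝ × EuclideanSpace ℝ (Fin n)) × EuclideanSpace ℝ (Fin n) =>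
      scaledKernel g f z.1.1 z.1.2 z.2 := by
  unfold scaledKernel
  fun_prop

theorem lintegral_scaledKernel {n : ℕ} {g f : EuclideanSpace ℝ (Fin n) → ℂ}
    (hg : Measurable g) (hf : Measurable f) {t : ℝ} (ht : 0 < t) :
    ∫⁻ x, ∫⁻ y, ‖scaledKernel g f t x y‖ₑ =
      ENNReal.ofReal t⁻¹ * ((∫⁻ x, ‖g x‖ₑ) * ∫⁻ y, ‖f y‖ₑ) := by
  simp_rw [enorm_scaledKernel g f ht]
  rw [lintegral_lintegral_swap (by fun_prop)]
  calc _ = ∫⁻ y, (ENNReal.ofReal t⁻¹ * ∫⁻ x, ‖g x‖ₑ) * ‖f y‖ₑ := by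
        refine lintegral_congr fun y => ?_
        rw [lintegral_mul_const _ (by fun_prop), lintegral_const_mul _ (by fun_prop),
          lintegral_kernel_left (fun z => ‖g z‖ₑ) hg.enorm ht, ← mul_assoc,
          ← ENNReal.ofReal_mul (by positivity)]
        congr 3
        rw [inv_pow]
        field_simp
        ring
    _ = _ := by rw [lintegral_const_mul _ hf.enorm, mul_assoc]

theorem integrable_scaledKernel {n : ℕ} {g f : EuclideanSpace ℝ (Fin n) → ℂ}
    (hg : Measurable g) (hgi : Integrable g) (hf : Measurable f) (hfi : Integrable f)
    {t : ℝ} (ht : 0 < t) :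
    Integrable (fun z : EuclideanSpace ℝ (Fin n) × EuclideanSpace ℝ (Fin n) =>
      scaledKernel g f t z.1 z.2) (volume.prod volume) := by
  have hm : Measurable (fun z : EuclideanSpace ℝ (Fin n) × EuclideanSpace ℝ (Fin n) =>
      scaledKernel g f t z.1 z.2) := by unfold scaledKernel; fun_prop
  refine ⟨hm.aestronglyMeasurable, ?_⟩
  rw [hasFiniteIntegral_iff_enorm, lintegral_prod _ hm.enorm.aemeasurable,
    lintegral_scaledKernel hg hf ht]
  exact ENNReal.mul_lt_top ENNReal.ofReal_lt_top (ENNReal.mul_lt_top hgi.2 hfi.2)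

/-- The `L¹` mass of the kernel at `t` is `t⁻¹ ‖g‖₁ ‖f‖₁`, whence the positive lower limit `a`. -/
theorem integrable_scaledKernel_prod {n : ℕ} {g f : EuclideanSpace ℝ (Fin n) → ℂ}
    (hg : Measurable g) (hgi : Integrable g) (hf : Measurable f) (hfi : Integrable f)
    {a : ℝ} (ha : 0 < a) (b : ℝ) :
    Integrable (fun z : (ℝ × EuclideanSpace ℝ (Fin n)) × EuclideanSpace ℝ (Fin n) =>
      scaledKernel g f z.1.1 z.1.2 z.2) (((volume.restrict (Ioc a b)).prod volume).prod volume) := by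
  have hm := measurable_scaledKernel hg hf
  refine ⟨hm.aestronglyMeasurable, ?_⟩
  rw [hasFiniteIntegral_iff_enorm, lintegral_prod _ hm.enorm.aemeasurable,
    lintegral_prod _ hm.enorm.lintegral_prod_right'.aemeasurable]
  calc _ ≤ ∫⁻ t in Ioc a b, ENNReal.ofReal a⁻¹ * ((∫⁻ x, ‖g x‖ₑ) * ∫⁻ y, ‖f y‖ₑ) := by
        refine setLIntegral_mono' measurableSet_Ioc fun t ht => ?_
        rw [lintegral_scaledKernel hg hf (ha.trans ht.1)]
        gcongr
        exact ht.1.le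
    _ < ⊤ := by
        rw [setLIntegral_const, Real.volume_Ioc]
        exact ENNReal.mul_lt_top (ENNReal.mul_lt_top ENNReal.ofReal_lt_top
          (ENNReal.mul_lt_top hgi.2 hfi.2)) ENNReal.ofReal_lt_top

theorem integrable_sliceOp_prod {n : ℕ} {g f : EuclideanSpace ℝ (Fin n) → ℂ}
    (hg : Measurable g) (hgi : Integrable g) (hf : Measurable f) (hfi : Integrable f)
    {a : ℝ} (ha : 0 < a) (b : ℝ) :
    Integrable (fun z : ℝ × EuclideanSpace ℝ (Fin n) => sliceOp g f z.1 z.2)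
      ((volume.restrict (Ioc a b)).prod volume) :=
  (integrable_scaledKernel_prod hg hgi hf hfi ha b).integral_prod_left

theorem integrable_integral_sliceOp {n : ℕ} {g f : EuclideanSpace ℝ (Fin n) → ℂ}
    (hg : Measurable g) (hgi : Integrable g) (hf : Measurable f) (hfi : Integrable f)
    {a : ℝ} (ha : 0 < a) (b : ℝ) :
    Integrable (fun x => ∫ t in Ioc a b, sliceOp g f t x) :=
  (integrable_sliceOp_prod hg hgi hf hfi ha b).integral_prod_right

/-- Boundedness of `g` gives integrability in `t` at every `x`, not just almost every one; this lets
the truncated integral be split at `1/2` pointwise. -/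
theorem integrableOn_sliceOp {n : ℕ} {g f : EuclideanSpace ℝ (Fin n) → ℂ}
    (hg : Measurable g) {M : ℝ} (hM : ∀ x, ‖g x‖ ≤ M) (hf : Measurable f) (hfi : Integrable f)
    {a : ℝ} (ha : 0 < a) (b : ℝ) (x : EuclideanSpace ℝ (Fin n)) :
    IntegrableOn (fun t => sliceOp g f t x) (Ioc a b) := by
  have hM0 : 0 ≤ M := (norm_nonneg _).trans (hM 0)
  have hm : Measurable fun z : ℝ × EuclideanSpace ℝ (Fin n) => scaledKernel g f z.1 x z.2 := by
    unfold scaledKernel; fun_prop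
  have h : Integrable (fun z : ℝ × EuclideanSpace ℝ (Fin n) => scaledKernel g f z.1 x z.2)
      ((volume.restrict (Ioc a b)).prod volume) := by
    refine ⟨hm.aestronglyMeasurable, ?_⟩
    rw [hasFiniteIntegral_iff_enorm, lintegral_prod _ hm.enorm.aemeasurable]
    calc _ ≤ ∫⁻ t in Ioc a b, ∫⁻ y,
          ENNReal.ofReal (a⁻¹ ^ (n + 1)) * ENNReal.ofReal M * ‖f y‖ₑ := by
          refine setLIntegral_mono' measurableSet_Ioc fun t ht => lintegral_mono fun y => ?_
          have ht0 := ha.trans ht.1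
          simp only
          rw [enorm_scaledKernel g f ht0, ← ofReal_norm (g _)]
          gcongr
          · exact ht.1.le
          · exact hM _
      _ < ⊤ := by
          rw [setLIntegral_const, Real.volume_Ioc, lintegral_const_mul _ hf.enorm]
          exact ENNReal.mul_lt_top (ENNReal.mul_lt_top (by finiteness) hfi.2)
            ENNReal.ofReal_lt_top
  exact h.integral_prod_left

theorem enorm_integral_sliceOp_le {n : ℕ} (g f : EuclideanSpace ℝ (Fin n) → ℂ)
    (x : EuclideanSpace ℝ (Fin n)) :
    ‖∫ t in Ioc (1 / 2 : ℝ) 1, sliceOp g f t x‖ₑ ≤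
      positiveOp (fun z => ‖g z‖ₑ) (fun z => ‖f z‖ₑ) x := by
  -- The endpoint `t = 1`, where the scaling in `y` degenerates, is a null set.
  rw [integral_Ioc_eq_integral_Ioo]
  refine (enorm_integral_le_lintegral_enorm _).trans ?_
  refine setLIntegral_mono' measurableSet_Ioo fun t ht => ?_
  refine (enorm_integral_le_lintegral_enorm _).trans (le_of_eq ?_)
  refine lintegral_congr fun y => ?_
  rw [enorm_scaledKernel g f (by linarith [ht.1])]

theorem integral_comp_smul_add {n : ℕ} (H : EuclideanSpace ℝ (Fin n) → ℂ) {a : ℝ} (ha : 0 < a)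
    (b : EuclideanSpace ℝ (Fin n)) :
    ∫ x, H (a • x + b) = ((a ^ n : ℝ) : ℂ)⁻¹ * ∫ x, H x := by
  rw [Measure.integral_comp_smul volume (fun x => H (x + b)) a, integral_add_right_eq_self,
    abs_of_pos (by positivity)]
  simp

/-- After Fubini, the substitution `x = t z + (1 - t) y` factors the character, so the two integrals
separate. -/
theorem fourier_sliceOp {n : ℕ} {g f : EuclideanSpace ℝ (Fin n) → ℂ}
    (hg : Measurable g) (hgi : Integrable g) (hf : Measurable f) (hfi : Integrable f)
    {t : ℝ} (ht : 0 < t) (ξ : EuclideanSpace ℝ (Fin n)) :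
    𝓕 (sliceOp g f t) ξ = (t : ℂ)⁻¹ * 𝓕 g (t • ξ) * 𝓕 f ((1 - t) • ξ) := by
  have hK := integrable_scaledKernel hg hgi hf hfi ht
  have hK' : Integrable (fun z : EuclideanSpace ℝ (Fin n) × EuclideanSpace ℝ (Fin n) =>
      (Real.fourierChar (-(inner ℝ z.1 ξ))) • scaledKernel g f t z.1 z.2)
      (volume.prod volume) := by
    refine hK.congr' (f := fun z : EuclideanSpace ℝ (Fin n) × EuclideanSpace ℝ (Fin n) =>
      scaledKernel g f t z.1 z.2) ?_ ?_
    · refine AEStronglyMeasurable.smul ?_ hK.1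
      exact (Continuous.subtype_val (Real.continuous_fourierChar.comp (by fun_prop :
        Continuous fun z : EuclideanSpace ℝ (Fin n) × EuclideanSpace ℝ (Fin n) =>
          -(inner ℝ z.1 ξ)))).aestronglyMeasurable
    · exact Eventually.of_forall fun z => by simp [Circle.norm_smul]
  have hinner : ∀ y, ∫ x, (Real.fourierChar (-(inner ℝ x ξ))) • scaledKernel g f t x y =
      (t : ℂ)⁻¹ * 𝓕 g (t • ξ) * ((Real.fourierChar (-(inner ℝ y ((1 - t) • ξ)))) • f y) := by
    intro y
    have h := integral_comp_smul_add (fun z =>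
      (Real.fourierChar (-(inner ℝ (t • z + (1 - t) • y) ξ))) •
        (((t⁻¹ ^ (n + 1) : ℝ) : ℂ) * g z * f y)) (inv_pos.2 ht) ((1 - t⁻¹) • y)
    have e1 : ∀ x, t • (t⁻¹ • x + (1 - t⁻¹) • y) + (1 - t) • y = x := by
      intro x
      have : t • (t⁻¹ • x + (1 - t⁻¹) • y) + (1 - t) • y =
        (t * t⁻¹) • x + (1 - t * t⁻¹) • y := by module
      rw [this, mul_inv_cancel₀ ht.ne']; simp
    have e2 : ∀ x, t⁻¹ • x + (1 - t⁻¹) • y = y + t⁻¹ • (x - y) := fun x => by module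
    simp only [e1] at h
    simp only [e2] at h
    simp only [scaledKernel]
    rw [h, Real.fourier_eq, ← integral_const_mul]
    rw [← integral_const_mul, ← integral_mul_const]
    congr 1
    ext z
    simp only [Circle.smul_def, smul_eq_mul]
    have e3 : (Real.fourierChar (-(inner ℝ (t • z + (1 - t) • y) ξ)) : ℂ) =
        Real.fourierChar (-(inner ℝ z (t • ξ))) *
          Real.fourierChar (-(inner ℝ y ((1 - t) • ξ))) := by
      rw [← Circle.coe_mul, ← AddChar.map_add_eq_mul]
      congr 2
      rw [inner_add_left, real_inner_smul_left, real_inner_smul_left, real_inner_smul_right,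
        real_inner_smul_right]
      ring
    rw [e3]
    have e4 : (((t⁻¹ ^ n : ℝ) : ℂ))⁻¹ * ((t⁻¹ ^ (n + 1) : ℝ) : ℂ) = (t : ℂ)⁻¹ := by
      have : (t : ℂ) ≠ 0 := by exact_mod_cast ht.ne'
      push_cast
      rw [pow_succ, inv_pow, inv_mul_cancel_left₀ (by positivity)]
    rw [← e4]
    ring
  calc 𝓕 (sliceOp g f t) ξ
      = ∫ x, ∫ y, (Real.fourierChar (-(inner ℝ x ξ))) • scaledKernel g f t x y := by
        rw [Real.fourier_eq]
        congr 1
        ext x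
        simp only [Circle.smul_def]
        rw [sliceOp, integral_smul]
    _ = ∫ y, ∫ x, (Real.fourierChar (-(inner ℝ x ξ))) • scaledKernel g f t x y :=
        integral_integral_swap hK'
    _ = _ := by
        simp_rw [hinner]
        rw [integral_const_mul, Real.fourier_eq f]

theorem fourier_integral_sliceOp {n : ℕ} {g f : EuclideanSpace ℝ (Fin n) → ℂ}
    (hg : Measurable g) (hgi : Integrable g) (hf : Measurable f) (hfi : Integrable f)
    {a : ℝ} (ha : 0 < a) (b : ℝ) (ξ : EuclideanSpace ℝ (Fin n)) :
    𝓕 (fun x => ∫ t in Ioc a b, sliceOp g f t x) ξ =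
      ∫ t in Ioc a b, (t : ℂ)⁻¹ * 𝓕 g (t • ξ) * 𝓕 f ((1 - t) • ξ) := by
  have hS := integrable_sliceOp_prod hg hgi hf hfi ha b
  have hS' : Integrable (fun z : ℝ × EuclideanSpace ℝ (Fin n) =>
      (Real.fourierChar (-(inner ℝ z.2 ξ))) • sliceOp g f z.1 z.2)
      ((volume.restrict (Ioc a b)).prod volume) := by
    refine hS.congr' (f := fun z : ℝ × EuclideanSpace ℝ (Fin n) => sliceOp g f z.1 z.2) ?_ ?_
    · refine AEStronglyMeasurable.smul ?_ hS.1
      exact (Continuous.subtype_val (Real.continuous_fourierChar.comp (by fun_prop :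
        Continuous fun z : ℝ × EuclideanSpace ℝ (Fin n) =>
          -(inner ℝ z.2 ξ)))).aestronglyMeasurable
    · exact Eventually.of_forall fun z => by simp [Circle.norm_smul]
  calc _ = ∫ x, ∫ t in Ioc a b, (Real.fourierChar (-(inner ℝ x ξ))) • sliceOp g f t x := by
        rw [Real.fourier_eq]
        congr 1
        ext x
        simp only [Circle.smul_def]
        rw [integral_smul]
    _ = ∫ t in Ioc a b, ∫ x, (Real.fourierChar (-(inner ℝ x ξ))) • sliceOp g f t x :=
        (integral_integral_swap (f := fun t x =>
          (Real.fourierChar (-(inner ℝ x ξ))) • sliceOp g f t x) hS').symm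
    _ = _ := by
        refine setIntegral_congr_fun measurableSet_Ioc fun t ht => ?_
        rw [← fourier_sliceOp hg hgi hf hfi (ha.trans ht.1), Real.fourier_eq]

/-! ### Plancherel on `L¹ ∩ L²` and inversion on `L²` -/

theorem eLpNorm_two_eq {α : Type*} [MeasurableSpace α] (μ : Measure α) (u : α → ℂ) :
    eLpNorm u 2 μ = (∫⁻ x, ‖u x‖ₑ ^ (2 : ℝ) ∂μ) ^ (1 / 2 : ℝ) := by
  rw [eLpNorm_eq_lintegral_rpow_enorm_toReal two_ne_zero ENNReal.ofNat_ne_top]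
  simp

theorem lintegral_sq_eq_eLpNorm {α : Type*} [MeasurableSpace α] (μ : Measure α) (u : α → ℂ) :
    ∫⁻ x, ‖u x‖ₑ ^ (2 : ℝ) ∂μ = eLpNorm u 2 μ ^ (2 : ℝ) := by
  rw [eLpNorm_two_eq, ← ENNReal.rpow_mul]
  norm_num

theorem continuous_fourier {n : ℕ} {f : EuclideanSpace ℝ (Fin n) → ℂ} (hf : Integrable f) :
    Continuous (𝓕 f) :=
  VectorFourier.fourierIntegral_continuous Real.continuous_fourierChar
    (innerSL ℝ).continuous₂ hf

theorem norm_fourier_le {n : ℕ} (f : EuclideanSpace ℝ (Fin n) → ℂ)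
    (ξ : EuclideanSpace ℝ (Fin n)) : ‖𝓕 f ξ‖ ≤ ∫ x, ‖f x‖ :=
  VectorFourier.norm_fourierIntegral_le_integral_norm _ _ _ _ _

theorem integral_fourier_mul {n : ℕ} {f : EuclideanSpace ℝ (Fin n) → ℂ} (hf : Integrable f)
    (ψ : 𝓢(EuclideanSpace ℝ (Fin n), ℂ)) :
    ∫ ξ, 𝓕 f ξ * ψ ξ = ∫ x, f x * 𝓕 ψ x := by
  have := VectorFourier.integral_fourierIntegral_smul_eq_flip
    (L := innerₗ (EuclideanSpace ℝ (Fin n))) Real.continuous_fourierChar continuous_inner hf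
    (ψ.integrable (μ := volume))
  simpa using! this

/-- The integral transform and its `L²` extension have the same pairing with every smooth compactly
supported function, both being obtained by moving `𝓕` onto the test function. -/
theorem fourier_ae_eq_fourier_toLp {n : ℕ} {f : EuclideanSpace ℝ (Fin n) → ℂ}
    (hf : Integrable f) (hf2 : MemLp f 2) :
    𝓕 f =ᵐ[volume] (𝓕 hf2.toLp : Lp ℂ 2 (volume : Measure (EuclideanSpace ℝ (Fin n)))) := by
  refine ae_eq_of_integral_contDiff_smul_eq (continuous_fourier hf).locallyIntegrable
    ((Lp.memLp _).locallyIntegrable (by norm_num)) fun g hg hgc => ?_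
  have hgc' : HasCompactSupport (fun x => (g x : ℂ)) := hgc.comp_left Complex.ofReal_zero
  set ψ : 𝓢(EuclideanSpace ℝ (Fin n), ℂ) :=
    hgc'.toSchwartzMap (Complex.ofRealCLM.contDiff.comp hg)
  have hψ : ∀ x, ψ x = g x := fun x => rfl
  have h1 := Lp.toTemperedDistribution_apply (𝓕 hf2.toLp) ψ
  rw [← Lp.fourier_toTemperedDistribution_eq, TemperedDistribution.fourier_apply,
    Lp.toTemperedDistribution_apply] at h1
  simp only [smul_eq_mul] at h1
  have h2 : ∫ x, g x • 𝓕 f x = ∫ x, 𝓕 f x * ψ x := by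
    refine integral_congr_ae (Eventually.of_forall fun x => ?_)
    simp [hψ, mul_comm]
  have h3 : ∫ x, g x • (𝓕 hf2.toLp : Lp ℂ 2 (volume : Measure (EuclideanSpace ℝ (Fin n)))) x =
      ∫ x, ψ x * (𝓕 hf2.toLp : Lp ℂ 2 (volume : Measure (EuclideanSpace ℝ (Fin n)))) x := by
    refine integral_congr_ae (Eventually.of_forall fun x => ?_)
    simp [hψ]
  rw [h2, h3, ← h1, integral_fourier_mul hf]
  refine integral_congr_ae ?_
  filter_upwards [hf2.coeFn_toLp] with x hx
  rw [hx, mul_comm, SchwartzMap.fourier_coe]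

theorem eLpNorm_fourier_eq {n : ℕ} {f : EuclideanSpace ℝ (Fin n) → ℂ}
    (hf : Integrable f) (hf2 : MemLp f 2) : eLpNorm (𝓕 f) 2 = eLpNorm f 2 := by
  rw [eLpNorm_congr_ae (fourier_ae_eq_fourier_toLp hf hf2), ← Lp.enorm_def, ← ofReal_norm,
    Lp.norm_fourier_eq, ofReal_norm, Lp.enorm_def, eLpNorm_congr_ae hf2.coeFn_toLp]

theorem exists_fourierInv_L2 {n : ℕ} {h : EuclideanSpace ℝ (Fin n) → ℂ} (hh : MemLp h 2) :
    ∃ v : EuclideanSpace ℝ (Fin n) → ℂ, MemLp v 2 ∧ eLpNorm v 2 = eLpNorm h 2 ∧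
      ∀ ψ : 𝓢(EuclideanSpace ℝ (Fin n), ℂ), ∫ x, v x * ψ x = ∫ ξ, h ξ * 𝓕⁻ ψ ξ := by
  refine ⟨(𝓕⁻ hh.toLp : Lp ℂ 2 (volume : Measure (EuclideanSpace ℝ (Fin n)))), Lp.memLp _, ?_,
    fun ψ => ?_⟩
  · have e : ‖(𝓕⁻ hh.toLp : Lp ℂ 2 (volume : Measure (EuclideanSpace ℝ (Fin n))))‖ =
        ‖hh.toLp‖ := (Lp.fourierTransformₗᵢ _ _).symm.norm_map _
    rw [← Lp.enorm_def, ← ofReal_norm, e, ofReal_norm, Lp.enorm_def,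
      eLpNorm_congr_ae hh.coeFn_toLp]
  · have h1 := Lp.toTemperedDistribution_apply (𝓕⁻ hh.toLp) ψ
    rw [← Lp.fourierInv_toTemperedDistribution_eq, TemperedDistribution.fourierInv_apply,
      Lp.toTemperedDistribution_apply] at h1
    simp only [smul_eq_mul] at h1
    simp_rw [mul_comm _ (ψ _)]
    rw [← h1]
    refine integral_congr_ae ?_
    filter_upwards [hh.coeFn_toLp] with x hx
    rw [hx, mul_comm, SchwartzMap.fourierInv_coe]

/-! ### Fourier bounds for the cut-off `φ` -/

/-- The partial derivative of a Schwartz function, as a Schwartz function. -/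
noncomputable def schwartzPartialDeriv {n : ℕ} (j : Fin n)
    (Φ : 𝓢(EuclideanSpace ℝ (Fin n), ℂ)) : 𝓢(EuclideanSpace ℝ (Fin n), ℂ) :=
  ∂_{(EuclideanSpace.single j (1 : ℝ))} Φ

theorem schwartzPartialDeriv_coe {n : ℕ} (j : Fin n) (Φ : 𝓢(EuclideanSpace ℝ (Fin n), ℂ)) :
    ⇑(schwartzPartialDeriv j Φ) = partialDeriv j Φ := by
  ext x
  rw [schwartzPartialDeriv, SchwartzMap.lineDerivOp_apply, partialDeriv]

theorem fourier_partialDeriv {n : ℕ} (j : Fin n) (Φ : 𝓢(EuclideanSpace ℝ (Fin n), ℂ))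
    (ξ : EuclideanSpace ℝ (Fin n)) :
    𝓕 (partialDeriv j Φ) ξ = 2 * Real.pi * Complex.I * (ξ j : ℂ) * 𝓕 (Φ : _ → ℂ) ξ := by
  have hm : (fun x : EuclideanSpace ℝ (Fin n) =>
      inner ℝ x (EuclideanSpace.single j (1 : ℝ))).HasTemperateGrowth := by fun_prop
  rw [← schwartzPartialDeriv_coe, ← SchwartzMap.fourier_coe, schwartzPartialDeriv,
    SchwartzMap.fourier_lineDerivOp_eq, smul_apply,
    SchwartzMap.smulLeftCLM_apply_apply hm, SchwartzMap.fourier_coe]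
  simp [EuclideanSpace.inner_single_right, mul_assoc]

theorem norm_fourier_le_lpNorm {n : ℕ} (Φ : 𝓢(EuclideanSpace ℝ (Fin n), ℂ))
    (ξ : EuclideanSpace ℝ (Fin n)) : ‖𝓕 (Φ : _ → ℂ) ξ‖ ≤ lpNorm Φ 1 volume := by
  rw [lpNorm_one_eq_integral_norm Φ.continuous.aestronglyMeasurable]
  exact norm_fourier_le _ _

theorem sq_mul_norm_fourier_le_lpNorm {n : ℕ} (j : Fin n) (Φ : 𝓢(EuclideanSpace ℝ (Fin n), ℂ))
    (ξ : EuclideanSpace ℝ (Fin n)) :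
    (2 * Real.pi * |ξ j|) ^ 2 * ‖𝓕 (Φ : _ → ℂ) ξ‖ ≤
      lpNorm (partialDeriv j (partialDeriv j Φ)) 1 volume := by
  have h := norm_fourier_le_lpNorm (schwartzPartialDeriv j (schwartzPartialDeriv j Φ)) ξ
  rw [schwartzPartialDeriv_coe, fourier_partialDeriv, schwartzPartialDeriv_coe,
    fourier_partialDeriv] at h
  refine le_trans (le_of_eq ?_) h
  simp only [norm_mul, Complex.norm_real, Complex.norm_I, Complex.norm_ofNat, Real.norm_eq_abs,
    abs_of_pos Real.pi_pos]
  ring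

theorem lintegral_frequency_kernel_le {n : ℕ} (j : Fin n) (Φ : 𝓢(EuclideanSpace ℝ (Fin n), ℂ))
    {ρ : ℝ} (hρ : 0 < ρ) (ξ : EuclideanSpace ℝ (Fin n)) :
    ∫⁻ t in Ioi (0 : ℝ), ENNReal.ofReal (2 * Real.pi * |ξ j|) * ‖𝓕 (Φ : _ → ℂ) (t • ξ)‖ₑ ≤
      ENNReal.ofReal (constC j Φ ρ) := by
  refine le_trans (le_of_eq ?_) (lintegral_Ioi_le_of_bounds (κ := fun t => ‖𝓕 (Φ : _ → ℂ) (t • ξ)‖)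
    (r := 2 * Real.pi * |ξ j|) hρ (by positivity) lpNorm_nonneg lpNorm_nonneg
    (fun t => norm_fourier_le_lpNorm Φ _) fun t => ?_)
  · refine lintegral_congr fun t => ?_
    rw [ENNReal.ofReal_mul (show 0 ≤ 2 * Real.pi * |ξ j| by positivity), ofReal_norm]
  · refine le_trans (le_of_eq ?_) (sq_mul_norm_fourier_le_lpNorm j Φ (t • ξ))
    simp only [PiLp.smul_apply, smul_eq_mul, abs_mul, mul_pow, sq_abs]
    ring

/-! ### The `L²` bound for `1/2 < t ≤ 1` -/

theorem lintegral_rpow_le_of_support {α : Type*} [MeasurableSpace α] {μ : Measure α}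
    {F : α → ℝ≥0∞} (hF : Measurable F) {s : Set α} (hs : MeasurableSet s)
    (hFs : ∀ x, x ∉ s → F x = 0) {p : ℝ} (hp : 0 < p) (hp2 : p ≤ 2) :
    ∫⁻ x, F x ^ p ∂μ ≤ (∫⁻ x, F x ^ (2 : ℝ) ∂μ) ^ (p / 2) * μ s ^ (1 - p / 2) := by
  have h : ∀ x, F x ^ p = (F x ^ (2 : ℝ)) ^ (p / 2) * (s.indicator 1 x) ^ (1 - p / 2) := by
    intro x
    rw [← ENNReal.rpow_mul, mul_div_cancel₀ _ two_ne_zero]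
    by_cases hx : x ∈ s
    · simp [hx]
    · simp [hFs x hx, hp]
  simp_rw [h]
  refine (ENNReal.lintegral_mul_norm_pow_le (by fun_prop)
    (measurable_one.indicator hs).aemeasurable (by positivity) (by linarith) (by ring)).trans ?_
  rw [lintegral_indicator_one hs]

/-- The squared bound collects `2 ^ (n(p-1)) * 2 ^ (n(2-p)) = 2 ^ n` and two equal powers of `V`;
its square root has the stated constant. -/
theorem rpow_bound_identity {n p V M N g : ℝ} (hp : 1 ≤ p) (hp2 : p ≤ 2)
    (ha : n * (1 - 1 / p) < 1) (hV : 0 ≤ V) (hM : 0 ≤ M) (hN : 0 ≤ N) (hg : 0 ≤ g) :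
    (2 ^ (n * (1 - 1 / p)) / (1 - n * (1 - 1 / p)) * g) ^ p * (N ^ p * V ^ (1 - p / 2)) *
        (2 ^ n * M * (N * V ^ (1 / 2 : ℝ))) ^ (2 - p) =
      (2 ^ (n / 2) / (1 - n * (1 - 1 / p)) ^ (p / 2) * (g ^ (p / 2) * M ^ (1 - p / 2)) *
        V ^ (1 - p / 2) * N) ^ (2 : ℝ) := by
  have hp0 : 0 < p := by linarith
  have h2 : 0 ≤ 2 - p := by linarith
  have hb : 0 < 1 - n * (1 - 1 / p) := by linarith
  set b := 1 - n * (1 - 1 / p) with hb_def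
  set a := n * (1 - 1 / p) with ha_def
  have e2 : (2 : ℝ) ^ (a * p) * 2 ^ (n * (2 - p)) = 2 ^ n := by
    rw [← Real.rpow_add two_pos]
    congr 1
    rw [ha_def]; field_simp; ring
  have eN : N ^ p * N ^ (2 - p) = N ^ (2 : ℝ) := by
    rw [← Real.rpow_add_of_nonneg hN hp0.le h2]; ring_nf
  have eV : V ^ (1 - p / 2) * V ^ (1 / 2 * (2 - p)) = V ^ ((1 - p / 2) * 2) := by
    rw [← Real.rpow_add_of_nonneg hV (by linarith) (by linarith)]; ring_nf
  rw [Real.mul_rpow (by positivity) hg, Real.div_rpow (by positivity) hb.le,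
    Real.mul_rpow (by positivity) (by positivity), Real.mul_rpow (by positivity) hM,
    Real.mul_rpow hN (by positivity), Real.mul_rpow (by positivity) hN,
    Real.mul_rpow (by positivity) (by positivity), Real.mul_rpow (by positivity) (by positivity),
    Real.mul_rpow (by positivity) (by positivity), Real.div_rpow (by positivity) (by positivity),
    ← Real.rpow_mul two_pos.le, ← Real.rpow_mul two_pos.le, ← Real.rpow_mul two_pos.le,
    ← Real.rpow_mul hV, ← Real.rpow_mul hV, ← Real.rpow_mul hb.le, ← Real.rpow_mul hg,
    ← Real.rpow_mul hM, div_mul_cancel₀ _ two_ne_zero, div_mul_cancel₀ _ two_ne_zero,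
    show (1 - p / 2) * 2 = 2 - p by ring]
  rw [show (1 - p / 2) * 2 = 2 - p by ring] at eV
  calc _ = ((2 : ℝ) ^ (a * p) * 2 ^ (n * (2 - p))) / b ^ p * g ^ p * M ^ (2 - p) *
        (V ^ (1 - p / 2) * V ^ (1 / 2 * (2 - p))) * (N ^ p * N ^ (2 - p)) := by ring
    _ = _ := by rw [e2, eN, eV]; ring

theorem eLpNorm_integral_sliceOp_le {n : ℕ} {g f : EuclideanSpace ℝ (Fin n) → ℂ}
    (hg : Measurable g) (hgi : Integrable g) {M : ℝ} (hM : ∀ x, ‖g x‖ ≤ M)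
    (hf : Measurable f) (hf2 : MemLp f 2) {Ω : Set (EuclideanSpace ℝ (Fin n))}
    (hΩ : MeasurableSet Ω) (hΩfin : volume Ω ≠ ⊤) (hfΩ : ∀ x, x ∉ Ω → f x = 0)
    {p : ℝ} (hp : 1 ≤ p) (hp2 : p ≤ 2) (ha : (n : ℝ) * (1 - 1 / p) < 1) :
    eLpNorm (fun x => ∫ t in Ioc (1 / 2 : ℝ) 1, sliceOp g f t x) 2 ≤
      ENNReal.ofReal (2 ^ ((n : ℝ) / 2) / (1 - (n : ℝ) * (1 - 1 / p)) ^ (p / 2) *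
        (lpNorm g 1 volume ^ (p / 2) * M ^ (1 - p / 2)) * (volume.real Ω) ^ (1 - p / 2) *
          lpNorm f 2 volume) := by
  have hp0 : 0 < p := by linarith
  have h2p : 0 ≤ 1 - p / 2 := by linarith
  have h2p' : 0 ≤ 2 - p := by linarith
  have hb : 0 < 1 - (n : ℝ) * (1 - 1 / p) := by linarith
  have hM0 : 0 ≤ M := (norm_nonneg _).trans (hM 0)
  set N := lpNorm f 2 volume
  have hN0 : 0 ≤ N := lpNorm_nonneg
  set g1 := lpNorm g 1 volume
  have hg0 : 0 ≤ g1 := lpNorm_nonneg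
  set V := volume.real Ω with hV
  have hV0 : 0 ≤ V := measureReal_nonneg
  have hVe : volume Ω = ENNReal.ofReal V := by rw [hV, ofReal_measureReal hΩfin]
  have hge : ∫⁻ x, ‖g x‖ₑ = ENNReal.ofReal g1 := by
    rw [ofReal_lpNorm (memLp_one_iff_integrable.2 hgi), eLpNorm_one_eq_lintegral_enorm]
  have hfe : ∫⁻ x, ‖f x‖ₑ ^ (2 : ℝ) = ENNReal.ofReal (N ^ (2 : ℝ)) := by
    rw [lintegral_sq_eq_eLpNorm, ← ofReal_lpNorm hf2,
      ENNReal.ofReal_rpow_of_nonneg hN0 zero_le_two]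
  have hfp : ∀ q : ℝ, 0 < q → q ≤ 2 →
      ∫⁻ x, ‖f x‖ₑ ^ q ≤ ENNReal.ofReal (N ^ q * V ^ (1 - q / 2)) := by
    intro q hq hq2
    refine (lintegral_rpow_le_of_support hf.enorm hΩ (fun x hx => by simp [hfΩ x hx]) hq
      hq2).trans (le_of_eq ?_)
    rw [hfe, hVe, ENNReal.ofReal_rpow_of_nonneg (by positivity) (by positivity),
      ENNReal.ofReal_rpow_of_nonneg (by positivity) (by linarith),
      ← ENNReal.ofReal_mul (by positivity), ← Real.rpow_mul hN0, mul_div_cancel₀ _ two_ne_zero]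
  have hf1 : ∫⁻ x, ‖f x‖ₑ ≤ ENNReal.ofReal (N * V ^ (1 / 2 : ℝ)) := by
    have := hfp 1 one_pos one_le_two
    norm_num at this
    exact this
  have hR0 : 0 ≤ 2 ^ ((n : ℝ) / 2) / (1 - (n : ℝ) * (1 - 1 / p)) ^ (p / 2) *
        (g1 ^ (p / 2) * M ^ (1 - p / 2)) * V ^ (1 - p / 2) * N := by positivity
  have hsq : ∫⁻ x, ‖∫ t in Ioc (1 / 2 : ℝ) 1, sliceOp g f t x‖ₑ ^ (2 : ℝ) ≤
      ENNReal.ofReal ((2 ^ ((n : ℝ) / 2) / (1 - (n : ℝ) * (1 - 1 / p)) ^ (p / 2) *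
        (g1 ^ (p / 2) * M ^ (1 - p / 2)) * V ^ (1 - p / 2) * N) ^ (2 : ℝ)) := by
    calc _ ≤ ∫⁻ x, positiveOp (fun z => ‖g z‖ₑ) (fun z => ‖f z‖ₑ) x ^ (2 : ℝ) := by
          gcongr with x
          exact enorm_integral_sliceOp_le g f x
      _ ≤ _ := lintegral_positiveOp_sq_le hg.enorm hf.enorm hp hp2 ha (M := ENNReal.ofReal M)
          fun x => by rw [← ofReal_norm]; exact ENNReal.ofReal_le_ofReal (hM x)
      _ ≤ (ENNReal.ofReal (2 ^ ((n : ℝ) * (1 - 1 / p)) / (1 - (n : ℝ) * (1 - 1 / p))) *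
            ENNReal.ofReal g1) ^ p * ENNReal.ofReal (N ^ p * V ^ (1 - p / 2)) *
            (ENNReal.ofReal (2 ^ (n : ℝ)) * ENNReal.ofReal M *
              ENNReal.ofReal (N * V ^ (1 / 2 : ℝ))) ^ (2 - p) := by
          rw [hge, Real.rpow_natCast, ENNReal.ofReal_pow zero_le_two, ENNReal.ofReal_ofNat]
          gcongr
          exact hfp p hp0 hp2
      _ = _ := by
          rw [← rpow_bound_identity hp hp2 ha hV0 hM0 hN0 hg0,
            ← ENNReal.ofReal_mul (by positivity), ← ENNReal.ofReal_mul (by positivity),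
            ← ENNReal.ofReal_mul (by positivity),
            ENNReal.ofReal_rpow_of_nonneg (by positivity) hp0.le,
            ENNReal.ofReal_rpow_of_nonneg (by positivity) h2p',
            ← ENNReal.ofReal_mul (by positivity), ← ENNReal.ofReal_mul (by positivity)]
  rw [eLpNorm_two_eq]
  refine (ENNReal.rpow_le_rpow hsq (by norm_num)).trans (le_of_eq ?_)
  rw [ENNReal.ofReal_rpow_of_nonneg (by positivity) (by norm_num), ← Real.rpow_mul hR0]
  norm_num

/-! ### The symbol for `0 < t ≤ 1/2`: `L²` bound and limit -/

/-- The Fourier transform of the slice operator at the parameter `t`. -/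
noncomputable def sliceSymbol {n : ℕ} (j : Fin n) (φ f : EuclideanSpace ℝ (Fin n) → ℂ) (t : ℝ)
    (ξ : EuclideanSpace ℝ (Fin n)) : ℂ :=
  2 * Real.pi * Complex.I * (ξ j : ℂ) * 𝓕 φ (t • ξ) * 𝓕 f ((1 - t) • ξ)

theorem continuous_sliceSymbol {n : ℕ} (j : Fin n) {φ f : EuclideanSpace ℝ (Fin n) → ℂ}
    (hφ : Integrable φ) (hf : Integrable f) :
    Continuous fun z : EuclideanSpace ℝ (Fin n) × ℝ => sliceSymbol j φ f z.2 z.1 := by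
  have h1 := continuous_fourier hφ
  have h2 := continuous_fourier hf
  unfold sliceSymbol
  fun_prop

theorem norm_sliceSymbol_le {n : ℕ} (j : Fin n) (φ f : EuclideanSpace ℝ (Fin n) → ℂ) (t : ℝ)
    (ξ : EuclideanSpace ℝ (Fin n)) :
    ‖sliceSymbol j φ f t ξ‖ ≤ 2 * Real.pi * ‖ξ‖ * (∫ x, ‖φ x‖) * ∫ x, ‖f x‖ := by
  unfold sliceSymbol
  simp only [norm_mul, Complex.norm_real, Complex.norm_I, Complex.norm_ofNat, mul_one]
  rw [Real.norm_of_nonneg Real.pi_pos.le]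
  gcongr
  · exact PiLp.norm_apply_le ξ j
  · exact norm_fourier_le _ _
  · exact norm_fourier_le _ _

theorem fourier_integral_sliceOp_partialDeriv {n : ℕ} (j : Fin n)
    (Φ : 𝓢(EuclideanSpace ℝ (Fin n), ℂ)) {f : EuclideanSpace ℝ (Fin n) → ℂ}
    (hf : Measurable f) (hfi : Integrable f) {a : ℝ} (ha : 0 < a) (b : ℝ)
    (ξ : EuclideanSpace ℝ (Fin n)) :
    𝓕 (fun x => ∫ t in Ioc a b, sliceOp (partialDeriv j Φ) f t x) ξ =
      ∫ t in Ioc a b, sliceSymbol j Φ f t ξ := by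
  rw [← schwartzPartialDeriv_coe, fourier_integral_sliceOp
    (schwartzPartialDeriv j Φ).continuous.measurable (schwartzPartialDeriv j Φ).integrable
    hf hfi ha]
  refine setIntegral_congr_fun measurableSet_Ioc fun t ht => ?_
  have ht0 : (t : ℂ) ≠ 0 := by exact_mod_cast (ha.trans ht.1).ne'
  simp only [schwartzPartialDeriv_coe, fourier_partialDeriv, sliceSymbol, PiLp.smul_apply,
    smul_eq_mul]
  push_cast
  field_simp

theorem memLp_integral_sliceSymbol {n : ℕ} (j : Fin n) (Φ : 𝓢(EuclideanSpace ℝ (Fin n), ℂ))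
    {ρ : ℝ} (hρ : 0 < ρ) {f : EuclideanSpace ℝ (Fin n) → ℂ} (hfi : Integrable f)
    (hf2 : MemLp f 2) :
    MemLp (fun ξ => ∫ t in Ioc (0 : ℝ) (1 / 2), sliceSymbol j Φ f t ξ) 2 ∧
    eLpNorm (fun ξ => ∫ t in Ioc (0 : ℝ) (1 / 2), sliceSymbol j Φ f t ξ) 2 ≤
      ENNReal.ofReal ((2 : ℝ) ^ (((n : ℝ) - 1) / 2) * constC j Φ ρ * lpNorm f 2 volume) := by
  have hC0 : 0 ≤ constC j Φ ρ := by
    unfold constC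
    have h1 : 0 ≤ lpNorm Φ 1 volume := lpNorm_nonneg
    have h2 : 0 ≤ lpNorm (partialDeriv j (partialDeriv j Φ)) 1 volume := lpNorm_nonneg
    positivity
  set N := lpNorm f 2 volume
  have hN0 : 0 ≤ N := lpNorm_nonneg
  have hm : StronglyMeasurable fun ξ => ∫ t in Ioc (0 : ℝ) (1 / 2), sliceSymbol j Φ f t ξ :=
    StronglyMeasurable.integral_prod_right (f := fun ξ t => sliceSymbol j Φ f t ξ)
      (continuous_sliceSymbol j Φ.integrable hfi).stronglyMeasurable
  have hfreq := lintegral_frequency_sq_le j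
    (continuous_fourier (Φ.integrable (μ := volume))).measurable.enorm
    (continuous_fourier hfi).measurable.enorm (lintegral_frequency_kernel_le j Φ hρ)
  have hsq : ∫⁻ ξ, ‖∫ t in Ioc (0 : ℝ) (1 / 2), sliceSymbol j Φ f t ξ‖ₑ ^ (2 : ℝ) ≤
      ENNReal.ofReal ((2 : ℝ) ^ ((n : ℝ) - 1) * constC j Φ ρ ^ (2 : ℝ) * N ^ (2 : ℝ)) := by
    calc _ ≤ ∫⁻ ξ, (∫⁻ t in Ioc (0 : ℝ) (1 / 2), ENNReal.ofReal (2 * Real.pi * |ξ j|) *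
          ‖𝓕 (Φ : _ → ℂ) (t • ξ)‖ₑ * ‖𝓕 f ((1 - t) • ξ)‖ₑ) ^ (2 : ℝ) := by
          gcongr with ξ
          refine (enorm_integral_le_lintegral_enorm _).trans (le_of_eq ?_)
          refine lintegral_congr fun t => ?_
          rw [sliceSymbol, enorm_mul, enorm_mul]
          congr 2
          rw [← ofReal_norm]
          simp [abs_of_pos Real.pi_pos]
      _ ≤ _ := hfreq
      _ = _ := by
          have hn1 : (2 : ℝ) ^ ((n : ℝ) - 1) = 2 ^ (n - 1) := by
            rw [← Nat.cast_pred j.pos, Real.rpow_natCast]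
          rw [lintegral_sq_eq_eLpNorm, eLpNorm_fourier_eq hfi hf2, ← ofReal_lpNorm hf2,
            ENNReal.ofReal_mul (by positivity), ENNReal.ofReal_mul (by positivity), hn1,
            ENNReal.ofReal_pow zero_le_two, ENNReal.ofReal_ofNat,
            ENNReal.ofReal_rpow_of_nonneg hC0 zero_le_two,
            ENNReal.ofReal_rpow_of_nonneg hN0 zero_le_two]
  have hle : eLpNorm (fun ξ => ∫ t in Ioc (0 : ℝ) (1 / 2), sliceSymbol j Φ f t ξ) 2 ≤
      ENNReal.ofReal ((2 : ℝ) ^ (((n : ℝ) - 1) / 2) * constC j Φ ρ * N) := by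
    rw [eLpNorm_two_eq]
    refine (ENNReal.rpow_le_rpow hsq (by norm_num)).trans (le_of_eq ?_)
    rw [ENNReal.ofReal_rpow_of_nonneg (by positivity) (by norm_num),
      Real.mul_rpow (by positivity) (by positivity), Real.mul_rpow (by positivity) (by positivity),
      ← Real.rpow_mul hC0, ← Real.rpow_mul hN0, ← Real.rpow_mul zero_le_two]
    norm_num
    ring_nf
  exact ⟨⟨hm.aestronglyMeasurable, hle.trans_lt ENNReal.ofReal_lt_top⟩, hle⟩

/-- The symbol is bounded by a multiple of `‖ξ‖`, uniformly in `t`, and the decay of `χ` makes this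
an integrable majorant. -/
theorem tendsto_integral_sliceSymbol_mul {n : ℕ} (j : Fin n)
    {φ f : EuclideanSpace ℝ (Fin n) → ℂ} (hφ : Integrable φ) (hf : Integrable f)
    (χ : 𝓢(EuclideanSpace ℝ (Fin n), ℂ)) :
    Tendsto (fun ε : ℝ => ∫ ξ, (∫ t in Ioc ε (1 / 2), sliceSymbol j φ f t ξ) * χ ξ) (𝓝[>] 0)
      (𝓝 (∫ ξ, (∫ t in Ioc (0 : ℝ) (1 / 2), sliceSymbol j φ f t ξ) * χ ξ)) := by
  have hc := continuous_sliceSymbol j hφ hf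
  have hev : ∀ᶠ ε : ℝ in 𝓝[>] 0, ε ∈ Ioo (0 : ℝ) (1 / 2) := Ioo_mem_nhdsGT (by norm_num)
  set D := 2 * Real.pi * (∫ x, ‖φ x‖) * ∫ x, ‖f x‖
  refine tendsto_integral_filter_of_dominated_convergence
    (fun ξ => D * (‖ξ‖ ^ 1 * ‖χ ξ‖)) ?_ ?_ ?_ ?_
  · refine Eventually.of_forall fun ε => ?_
    exact ((StronglyMeasurable.integral_prod_right (f := fun ξ t => sliceSymbol j φ f t ξ)
      hc.stronglyMeasurable).mul χ.continuous.stronglyMeasurable).aestronglyMeasurable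
  · filter_upwards [hev] with ε hε
    refine Eventually.of_forall fun ξ => ?_
    have h1 : ‖∫ t in Ioc ε (1 / 2), sliceSymbol j φ f t ξ‖ ≤
        (2 * Real.pi * ‖ξ‖ * (∫ x, ‖φ x‖) * ∫ x, ‖f x‖) * volume.real (Ioc ε (1 / 2)) :=
      norm_setIntegral_le_of_norm_le_const (by simp) fun t _ => norm_sliceSymbol_le j φ f t ξ
    have h2 : volume.real (Ioc ε (1 / 2)) ≤ 1 := by
      rw [Real.volume_real_Ioc_of_le hε.2.le]; linarith [hε.1]
    have h3 : 0 ≤ ∫ x, ‖φ x‖ := integral_nonneg fun _ => norm_nonneg _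
    have h4 : 0 ≤ ∫ x, ‖f x‖ := integral_nonneg fun _ => norm_nonneg _
    rw [norm_mul]
    calc _ ≤ (2 * Real.pi * ‖ξ‖ * (∫ x, ‖φ x‖) * ∫ x, ‖f x‖) * 1 * ‖χ ξ‖ := by
          gcongr
          exact h1.trans (by gcongr)
      _ = _ := by simp only [D]; ring
  · exact (χ.integrable_pow_mul volume 1).const_mul D
  · refine Eventually.of_forall fun ξ => Tendsto.mul_const _ ?_
    have hct : Continuous fun t => sliceSymbol j φ f t ξ :=
      hc.comp (by fun_prop : Continuous fun t : ℝ => (ξ, t))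
    have hprim : Continuous fun ε : ℝ => ∫ t in ε..(1 / 2), sliceSymbol j φ f t ξ :=
      (intervalIntegral.continuous_primitive (μ := volume)
        (fun a b => hct.intervalIntegrable a b) (1 / 2)).neg.congr
        fun ε => (intervalIntegral.integral_symm _ _).symm
    have h0 := (hprim.tendsto 0).mono_left (nhdsWithin_le_nhds (s := Ioi 0))
    rw [intervalIntegral.integral_of_le (by norm_num)] at h0
    refine h0.congr' ?_
    filter_upwards [hev] with ε hε
    rw [intervalIntegral.integral_of_le hε.2.le]

/-! ### Assembly of the two ranges -/

/-- By continuity, exceeding the essential supremum at one point of `Ω` would force it on a nonempty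
open set, which has positive measure. Thus the `L^∞(Ω)` norm serves as the pointwise bound `M`. -/
theorem norm_le_lpNorm_top_of_support {n : ℕ} {g : EuclideanSpace ℝ (Fin n) → ℂ}
    (hg : Continuous g) {Ω : Set (EuclideanSpace ℝ (Fin n))} (hΩ : IsOpen Ω)
    (hgm : MemLp g ⊤ (volume.restrict Ω)) (hgΩ : ∀ x, x ∉ Ω → g x = 0)
    (x : EuclideanSpace ℝ (Fin n)) : ‖g x‖ ≤ lpNorm g ⊤ (volume.restrict Ω) := by
  by_contra! hx
  have hxΩ : x ∈ Ω := by
    by_contra h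
    rw [hgΩ x h, norm_zero] at hx
    exact absurd lpNorm_nonneg hx.not_ge
  have hopen : IsOpen (Ω ∩ {y | lpNorm g ⊤ (volume.restrict Ω) < ‖g y‖}) :=
    hΩ.inter (isOpen_lt continuous_const hg.norm)
  have hnull : volume (Ω ∩ {y | lpNorm g ⊤ (volume.restrict Ω) < ‖g y‖}) = 0 := by
    have h := (ae_restrict_iff' hΩ.measurableSet).1 (ae_le_lpNorm_exponent_top hgm)
    rw [ae_iff] at h
    refine measure_mono_null (fun y hy => ?_) h
    simpa using hy
  rw [hopen.measure_eq_zero_iff volume] at hnull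
  exact (hnull ▸ (⟨hxΩ, hx⟩ : x ∈ Ω ∩ {y | lpNorm g ⊤ (volume.restrict Ω) < ‖g y‖}) :
    x ∈ (∅ : Set _))

theorem truncatedOp_congr {n : ℕ} (j : Fin n) (φ : EuclideanSpace ℝ (Fin n) → ℂ)
    {f f' : EuclideanSpace ℝ (Fin n) → ℂ} (h : f =ᵐ[volume] f') :
    truncatedOp j φ f = truncatedOp j φ f' := by
  ext ε x
  unfold truncatedOp
  congr 1
  ext t
  congr 1
  refine integral_congr_ae ?_
  filter_upwards [h] with y hy
  rw [hy]

theorem exists_temperedLimit {n : ℕ} (j : Fin n) {ρ : ℝ} (hρ : 0 < ρ)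
    {Ω : Set (EuclideanSpace ℝ (Fin n))} (hΩo : IsOpen Ω) (hΩb : Bornology.IsBounded Ω)
    (Φ : 𝓢(EuclideanSpace ℝ (Fin n), ℂ)) (hΦΩ : tsupport Φ ⊆ Ω)
    {f : EuclideanSpace ℝ (Fin n) → ℂ} (hfm : Measurable f) (hf : MemLp f 2 volume)
    (hfΩ : ∀ x, x ∉ Ω → f x = 0) :
    ∃ Tf : EuclideanSpace ℝ (Fin n) → ℂ,
      MemLp Tf 2 volume ∧
      IsTemperedLimit (truncatedOp j Φ f) Tf ∧
      ∀ p : ℝ, 1 ≤ p → p ≤ 2 → (n : ℝ) * (1 - 1 / p) < 1 →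
        lpNorm Tf 2 volume ≤
          ((2 : ℝ) ^ (((n : ℝ) - 1) / 2) * constC j Φ ρ +
            (2 : ℝ) ^ ((n : ℝ) / 2) / (1 - (n : ℝ) * (1 - 1 / p)) ^ (p / 2) *
              constCtilde j Φ Ω p * (volume.real Ω) ^ (1 - p / 2)) *
          lpNorm f 2 volume := by
  have hΩfin : volume Ω ≠ ⊤ := hΩb.measure_lt_top.ne
  have hfi : Integrable f := by
    have h1 : IntegrableOn f Ω := by
      have : IsFiniteMeasure (volume.restrict Ω) := ⟨by simpa using hΩfin.lt_top⟩
      exact (hf.restrict Ω).integrable one_le_two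
    exact (integrableOn_iff_integrable_of_support_subset fun x hx => by
      by_contra h; exact hx (hfΩ x h)).1 h1
  set g := partialDeriv j Φ with hg_def
  have hg : g = schwartzPartialDeriv j Φ := (schwartzPartialDeriv_coe j Φ).symm
  have hgc : Continuous g := hg ▸ (schwartzPartialDeriv j Φ).continuous
  have hgi : Integrable g := hg ▸ (schwartzPartialDeriv j Φ).integrable
  have hgtop : MemLp g ⊤ (volume.restrict Ω) :=
    hg ▸ ((schwartzPartialDeriv j Φ).memLp ⊤ volume).restrict Ω
  have hgΩ : ∀ x, x ∉ Ω → g x = 0 := by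
    intro x hx
    have h0 : fderiv ℝ Φ x = 0 := by
      by_contra h
      exact hx (hΦΩ (support_fderiv_subset ℝ h))
    rw [hg_def, partialDeriv, Φ.differentiableAt.lineDeriv_eq_fderiv, h0]
    rfl
  have hM := norm_le_lpNorm_top_of_support hgc hΩo hgtop hgΩ
  have hgm := hgc.measurable
  set A : EuclideanSpace ℝ (Fin n) → ℂ := fun x => ∫ t in Ioc (1 / 2 : ℝ) 1, sliceOp g f t x
  have hAi : Integrable A := integrable_integral_sliceOp hgm hgi hfm hfi (by norm_num) 1
  have hAle := fun {p : ℝ} => eLpNorm_integral_sliceOp_le (p := p) hgm hgi hM hfm hf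
    hΩo.measurableSet hΩfin hfΩ
  -- Only finiteness matters here, so `p = 1` is taken, where the exponent `n/p'` is `0`.
  have hA2 : MemLp A 2 := ⟨hAi.1, (hAle le_rfl one_le_two (by simp)).trans_lt
    ENNReal.ofReal_lt_top⟩
  obtain ⟨hh, hhle⟩ := memLp_integral_sliceSymbol j Φ hρ hfi hf
  obtain ⟨v, hv2, hvnorm, hvψ⟩ := exists_fourierInv_L2 hh
  -- `v` is the inverse transform of the symbol integrated over `(0, 1/2]`; `A` is the part over
  -- `(1/2, 1]`, which does not depend on `ε`.
  refine ⟨fun x => v x + A x, hv2.add hA2, fun ψ => ?_, fun p hp hp2 hpn => ?_⟩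
  · have hev : ∀ᶠ ε : ℝ in 𝓝[>] 0, ε ∈ Ioo (0 : ℝ) (1 / 2) := Ioo_mem_nhdsGT (by norm_num)
    have hmul : ∀ u : EuclideanSpace ℝ (Fin n) → ℂ, Integrable u →
        Integrable fun x => u x * ψ x := fun u hu =>
      hu.mul_bdd (c := ‖ψ.toBoundedContinuousFunction‖) ψ.continuous.aestronglyMeasurable
        (Eventually.of_forall fun x => ψ.toBoundedContinuousFunction.norm_coe_le_norm x)
    have hvi : Integrable fun x => v x * ψ x := hv2.integrable_mul (ψ.memLp 2 volume)
    set B : ℝ → EuclideanSpace ℝ (Fin n) → ℂ := fun ε x =>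
      ∫ t in Ioc ε (1 / 2), sliceOp g f t x
    have hBi : ∀ ε, 0 < ε → Integrable (B ε) := fun ε hε =>
      integrable_integral_sliceOp hgm hgi hfm hfi hε _
    have hsplit : ∀ ε ∈ Ioo (0 : ℝ) (1 / 2), truncatedOp j Φ f ε = fun x => B ε x + A x := by
      intro ε hε
      ext x
      have h1 := integrableOn_sliceOp hgm hM hfm hfi hε.1 (1 / 2) x
      have h2 := integrableOn_sliceOp hgm hM hfm hfi (a := 1 / 2) (by norm_num) 1 x
      rw [truncatedOp_eq, ← intervalIntegral.integral_add_adjacent_intervals (b := 1 / 2)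
        ((intervalIntegrable_iff_integrableOn_Ioc_of_le hε.2.le).2 h1)
        ((intervalIntegrable_iff_integrableOn_Ioc_of_le (by norm_num)).2 h2),
        intervalIntegral.integral_of_le hε.2.le, intervalIntegral.integral_of_le (by norm_num)]
    refine ⟨?_, ?_, ?_⟩
    · filter_upwards [hev] with ε hε
      rw [hsplit ε hε]
      exact hmul _ ((hBi ε hε.1).add hAi)
    · simp only [add_mul]
      exact hvi.add (hmul A hAi)
    · have hlim := (tendsto_integral_sliceSymbol_mul j Φ.integrable hfi (𝓕⁻ ψ)).add_const
        (∫ x, A x * ψ x)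
      rw [← hvψ, ← integral_add hvi (hmul A hAi)] at hlim
      simp only [add_mul]
      refine hlim.congr' ?_
      filter_upwards [hev] with ε hε
      rw [hsplit ε hε]
      simp only [add_mul]
      rw [integral_add (hmul _ (hBi ε hε.1)) (hmul A hAi)]
      congr 1
      have h1 := integral_fourier_mul (hBi ε hε.1) (𝓕⁻ ψ)
      rw [FourierTransform.fourier_fourierInv_eq] at h1
      rw [← h1]
      refine integral_congr_ae (Eventually.of_forall fun ξ => ?_)
      simp only
      rw [fourier_integral_sliceOp_partialDeriv j Φ hfm hfi hε.1]
  · have hv : lpNorm v 2 volume ≤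
        (2 : ℝ) ^ (((n : ℝ) - 1) / 2) * constC j Φ ρ * lpNorm f 2 volume := by
      rw [← toReal_eLpNorm hv2.1, hvnorm]
      refine ENNReal.toReal_le_of_le_ofReal ?_ hhle
      have h1 : 0 ≤ lpNorm Φ 1 volume := lpNorm_nonneg
      have h2 : 0 ≤ lpNorm (partialDeriv j (partialDeriv j Φ)) 1 volume := lpNorm_nonneg
      have h3 : 0 ≤ lpNorm f 2 volume := lpNorm_nonneg
      unfold constC
      positivity
    have hA : lpNorm A 2 volume ≤
        (2 : ℝ) ^ ((n : ℝ) / 2) / (1 - (n : ℝ) * (1 - 1 / p)) ^ (p / 2) *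
          constCtilde j Φ Ω p * (volume.real Ω) ^ (1 - p / 2) * lpNorm f 2 volume := by
      rw [← toReal_eLpNorm hA2.1]
      refine ENNReal.toReal_le_of_le_ofReal ?_ (hAle hp hp2 hpn)
      have h1 : 0 ≤ lpNorm g 1 volume := lpNorm_nonneg
      have h2 : 0 ≤ lpNorm g ⊤ (volume.restrict Ω) := lpNorm_nonneg
      have h3 : 0 ≤ lpNorm f 2 volume := lpNorm_nonneg
      have h4 : 0 ≤ volume.real Ω := measureReal_nonneg
      have h5 : 0 < 1 - (n : ℝ) * (1 - 1 / p) := by linarith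
      unfold constCtilde
      positivity
    calc _ ≤ lpNorm v 2 volume + lpNorm A 2 volume := lpNorm_add_le hv2 one_le_two
      _ ≤ _ := add_le_add hv hA
      _ = _ := by ring

theorem mainTheorem3 (n : ℕ) (hn : 2 ≤ n) (j : Fin n)
    (ρ : ℝ) (hρ : 0 < ρ)
    (Ω : Set (EuclideanSpace ℝ (Fin n))) (hΩo : IsOpen Ω) (hΩb : Bornology.IsBounded Ω)
    (hball : Metric.ball 0 ρ ⊆ Ω) (hstar : ∀ z ∈ Metric.ball 0 ρ, StarConvex ℝ z Ω)
    (φ : EuclideanSpace ℝ (Fin n) → ℂ) (hφ : ContDiff ℝ ∞ φ) (hφc : HasCompactSupport φ)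
    (hφB : tsupport φ ⊆ Metric.ball 0 ρ)
    (f : EuclideanSpace ℝ (Fin n) → ℂ) (hf : MemLp f 2 volume)
    (hfΩ : ∀ᵐ x ∂volume, x ∉ Ω → f x = 0) :
    ∃ Tf : EuclideanSpace ℝ (Fin n) → ℂ,
      MemLp Tf 2 volume ∧
      IsTemperedLimit (truncatedOp j φ f) Tf ∧
      -- below, `1 - n / p'` is written with `1 / p' = 1 - 1 / p`
      ∀ p : ℝ, 1 ≤ p → p < (n : ℝ) / ((n : ℝ) - 1) →
        lpNorm Tf 2 (volume.restrict Ω) ≤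
          ((2 : ℝ) ^ (((n : ℝ) - 1) / 2) * constC j φ ρ +
            (2 : ℝ) ^ ((n : ℝ) / 2) / (1 - (n : ℝ) * (1 - 1 / p)) ^ (p / 2) *
              constCtilde j φ Ω p * (volume.real Ω) ^ (1 - p / 2)) *
          lpNorm f 2 (volume.restrict Ω) := by
  have hΩm := hΩo.measurableSet
  -- A Borel representative of `f` vanishing everywhere off `Ω`; the truncated operator does not see
  -- the change.
  set f' := Ω.indicator (hf.1.mk f) with hf'
  have hff' : f =ᵐ[volume] f' := by
    filter_upwards [hf.1.ae_eq_mk, hfΩ] with x h1 h2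
    by_cases hx : x ∈ Ω
    · rw [hf', indicator_of_mem hx, h1]
    · rw [hf', indicator_of_notMem hx, h2 hx]
  have hf'm : Measurable f' := hf.1.stronglyMeasurable_mk.measurable.indicator hΩm
  obtain ⟨Tf, hTf, hlim, hbound⟩ := exists_temperedLimit j hρ hΩo hΩb (hφc.toSchwartzMap hφ)
    (hφB.trans hball) hf'm ((memLp_congr_ae hff').1 hf)
    (fun x hx => indicator_of_notMem hx _)
  refine ⟨Tf, hTf, ?_, fun p hp hpn => ?_⟩
  · rw [truncatedOp_congr j φ hff']
    exact hlim
  · have hn2 : (2 : ℝ) ≤ n := by exact_mod_cast hn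
    have hn1 : 0 < (n : ℝ) - 1 := by linarith
    have hp0 : 0 < p := by linarith
    rw [lt_div_iff₀ hn1] at hpn
    -- Since `n ≥ 2`, `n/(n-1) ≤ 2`; the interpolation between `L^p` and `L^∞` needs this.
    have hp2 : p ≤ 2 := by nlinarith
    have hpa : (n : ℝ) * (1 - 1 / p) < 1 := by
      rw [one_sub_div hp0.ne', ← mul_div_assoc, div_lt_one hp0]
      linarith
    have hN : lpNorm f' 2 volume = lpNorm f 2 (volume.restrict Ω) := by
      rw [← toReal_eLpNorm hf'm.aestronglyMeasurable, ← toReal_eLpNorm hf.1.restrict,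
        eLpNorm_congr_ae (ae_restrict_of_ae hff'),
        eLpNorm_restrict_eq_of_support_subset support_indicator_subset]
    have hT : lpNorm Tf 2 (volume.restrict Ω) ≤ lpNorm Tf 2 volume := by
      rw [← toReal_eLpNorm hTf.1, ← toReal_eLpNorm hTf.1.restrict]
      exact ENNReal.toReal_mono hTf.2.ne (eLpNorm_mono_measure Tf Measure.restrict_le_self)
    rw [← hN]
    exact hT.trans (hbound p hp hp2 hpa)
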